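/- For integers $a,b\ge 0$ let $\mathcal R_{a\times b}$ be the $a\times b$ rectangular grid graph (the rectangular subgraph of the square lattice with $a$ rows of $b$ vertices), with its vertices properly coloured black and white. Write $m_G$ for the number of perfect matchings of a graph $G$; for $G=\mathcal R_{a\times b}$ this is the number of domino tilings of the $a\times b$ rectangle. A channel of $G$ is a set $C$ of vertices such that every vertex of $G$ is adjacent to an even number of vertices in $C$; let $\mathcal C_B(G)$ be the set of channels consisting only of black vertices (including the empty one). For integers $m,n\ge 1$, the internal faces of $\mathcal R_{(m+1)\times(n+1)}$ are its $mn$ unit squares; a vertex is external if it lies on the boundary of the rectangle and internal otherwise. A billiard nest is a set $B$ of internal faces such that at every internal black vertex all, none, or every second one (in cyclic order) of the incident faces are in $B$, and at every external black vertex all or none of the incident internal faces are in $B$. The path basis is the set of connected components of the graph on the internal faces in which two faces are joined if they are incident to a common internal black vertex $b$ and separated by an even number of edges at $b$, or are incident to a common external black vertex. Let $m,n\ge 1$ be integers. 1. If $(m+1)(n+1)$ is even, then the path basis of $\mathcal R_{(m+1)\times(n+1)}$ is a basis of the $\mathbf Z/2\mathbf Z$-vector space of billiard nests (with symmetric difference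 as addition), and it has exactly $\frac{\gcd(m,n)+1}{2}$ elements. 2. If $(m-1)(n-1)$ is even, then $|\mathcal C_B(\mathcal R_{(m-1)\times(n-1)})| = 2^{\frac{\gcd(m,n)-1}{2}}$. 3. The number $m_{\mathcal R_{(m-1)\times(n-1)}}$ of perfect matchings is divisible by $2^{\frac{\gcd(m,n)-1}{2}}$. (If $\gcd(m,n)$ is even, so that the exponent is not an integer, this means that the number is $0$.) 4. The number $m_{\mathcal R_{(m-1)\times(n-1)}}$ is odd if and only if $\gcd(m,n)=1$. Parts 1 and 2 hold for either of the two proper colourings. -/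

import Mathlib

namespace GridChannels

/-- The `a × b` rectangular grid graph: `(x, y)` and `(x', y')` are adjacent iff they agree in one
coordinate and differ by exactly one in the other. -/
abbrev rectGrid (a b : ℕ) : SimpleGraph (Fin a × Fin b) :=
  SimpleGraph.boxProd (SimpleGraph.pathGraph a) (SimpleGraph.pathGraph b)

/-- The number of perfect matchings of a finite graph. For a rectangular grid graph this is the
number of domino tilings of the rectangle. -/
noncomputable def numMatchings {V : Type*} [Finite V] (G : SimpleGraph V) : ℕ :=
  Set.ncard {M : G.Subgraph | M.IsPerfectMatching}

/-- A channel of a finite graph: a vertex set `C` such that every vertex of the graph is adjacent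
to an even number of vertices of `C`. -/
def IsChannel {V : Type*} [Finite V] (G : SimpleGraph V) (C : Set V) : Prop :=
  ∀ v : V, Even (G.neighborSet v ∩ C).ncard

/-- The channels that use only black vertices. A bipartite graph comes with a proper colouring of
its vertices; `true` stands for black and `false` for white. -/
def blackChannels {V : Type*} [Finite V] (G : SimpleGraph V) (c : G.Coloring Bool) : Set (Set V) :=
  {C | IsChannel G C ∧ ∀ v ∈ C, c v = true}

/-- The internal faces of the `(m+1) × (n+1)` grid graph are its `m * n` unit squares. The face
`(i, j)` is the square with corners `(i, j)`, `(i+1, j)`, `(i+1, j+1)`, `(i, j+1)`. -/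
abbrev Face (m n : ℕ) : Type := Fin m × Fin n

/-- A vertex of the `(m+1) × (n+1)` grid graph is external if it is incident to the unbounded face,
that is, if it lies on the boundary of the rectangle. -/
def IsExternal {m n : ℕ} (v : Fin (m + 1) × Fin (n + 1)) : Prop :=
  v.1.val = 0 ∨ v.1.val = m ∨ v.2.val = 0 ∨ v.2.val = n

/-- `FaceAt v k f`: the unit square `f` has `v` as a corner and lies in the `k`-th quadrant at `v`,
where the quadrants are numbered `0, 1, 2, 3` counterclockwise from the upper right one.
Cyclically consecutive quadrants are separated by one edge incident to `v`. -/
def FaceAt {m n : ℕ} (v : Fin (m + 1) × Fin (n + 1)) (k : Fin 4) (f : Face m n) : Prop :=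
  match k with
  | 0 => f.1.val = v.1.val ∧ f.2.val = v.2.val
  | 1 => f.1.val + 1 = v.1.val ∧ f.2.val = v.2.val
  | 2 => f.1.val + 1 = v.1.val ∧ f.2.val + 1 = v.2.val
  | 3 => f.1.val = v.1.val ∧ f.2.val + 1 = v.2.val

/-- The face `f` is incident to the vertex `v`. -/
def Incident {m n : ℕ} (v : Fin (m + 1) × Fin (n + 1)) (f : Face m n) : Prop :=
  ∃ k, FaceAt v k f

/-- A set `B` of internal faces is a billiard nest if at every internal black vertex either all, or
none, or every second one of the incident faces are in `B`, and at every external black vertex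
either all or none of the incident internal faces are in `B`. -/
def IsBilliardNest {m n : ℕ} (c : (rectGrid (m + 1) (n + 1)).Coloring Bool)
    (B : Set (Face m n)) : Prop :=
  ∀ b, c b = true →
    (¬ IsExternal b →
      (∀ f, Incident b f → f ∈ B) ∨ (∀ f, Incident b f → f ∉ B) ∨
      (∀ k f, FaceAt b k f → (f ∈ B ↔ Even k.val)) ∨
      (∀ k f, FaceAt b k f → (f ∈ B ↔ Odd k.val))) ∧
    (IsExternal b → (∀ f, Incident b f → f ∈ B) ∨ (∀ f, Incident b f → f ∉ B))

/-- The graph on the internal faces in which two distinct faces are joined if they are incident to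
the same internal black vertex `b` and separated by an even number of edges at `b`, or if they are
incident to the same external black vertex. -/
def billiardGraph {m n : ℕ} (c : (rectGrid (m + 1) (n + 1)).Coloring Bool) :
    SimpleGraph (Face m n) :=
  SimpleGraph.fromRel fun f f' => ∃ b, c b = true ∧
    ((¬ IsExternal b ∧ ∃ k k' : Fin 4, FaceAt b k f ∧ FaceAt b k' f' ∧ Even (k.val + k'.val)) ∨
      (IsExternal b ∧ Incident b f ∧ Incident b f'))

/-- The path basis: the connected components of the graph above, as sets of internal faces. -/
def pathBasis {m n : ℕ} (c : (rectGrid (m + 1) (n + 1)).Coloring Bool) : Set (Set (Face m n)) :=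
  {P | ∃ K : (billiardGraph c).ConnectedComponent, P = K.supp}

/-- The indicator vector of a set of faces over `ℤ/2ℤ`; symmetric difference of sets is addition of
vectors. -/
noncomputable def faceVec {m n : ℕ} (P : Set (Face m n)) : Face m n → ZMod 2 :=
  Set.indicator P 1

end GridChannels

/-! Every unit square has exactly one diagonal joining two black corners. Following these diagonals
is billiards in `[0, m] × [0, n]`: straight on at an internal black vertex, reflected at an external
one. Give a diagonal on `x - y = k` or `x + y = k` the position `|k|` (`diagPos`); this already
makes the identifications of the walls `x = 0` and `y = 0`. The walls `x = m` and `y = n` reflect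
positions in `m` and in `n`, and by Euclid's algorithm (`eq_fold_gcd_of_reflections`) what survives
is the distance `fold g` to the multiples of `2 * g`, where `g = gcd m n`. It is a complete
invariant of the components (`ncard_pathBasis`), and for odd `g` it takes `(g + 1) / 2` values.
Nests are the unions of components, which gives the basis.

A black channel is a kernel vector modulo 2 of the adjacency matrix. Padded by zeros on the boundary
of `[0, m] × [0, n]`, it solves the discrete wave equation, so it has a d'Alembert form `F (x + y) +
F |x - y|` (`exists_waves`). Vanishing on the far walls again means reflection in `m` and in `n`, so
`F` factors through `fold g`. Adding a constant to `F` on the relevant parity class changes nothing,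
so `(g - 1) / 2` free values remain (`card_blackKernel`).

For tilings, one side may be taken even when `g` is odd. Flips connect all tilings
(`IsTiling.flip_induction`) and preserve the term of a tiling in the Kasteleyn determinant, so this
determinant counts tilings (`numMatchings_eq_det_kasteleyn`). Modulo 2 the transposed Kasteleyn
matrix has the black channels as its kernel. A kernel of dimension `d` forces `2 ^ d` to divide the
determinant (`pow_finrank_ker_dvd_det`), and a trivial kernel makes it odd. For even `g` the number
of vertices is odd. -/

namespace GridChannels

/-! ### Reflections on the line and the Euclidean algorithm -/

/-- The distance from `t` to the nearest multiple of `2 * g`. -/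
def fold (g : ℕ) (t : ℤ) : ℕ := ((t : ZMod (2 * g)).valMinAbs).natAbs

theorem fold_eq_of_dvd_sub {g : ℕ} {s t : ℤ} (h : (2 * g : ℤ) ∣ s - t) : fold g s = fold g t := by
  have : ((s : ℤ) : ZMod (2 * g)) = (t : ℤ) := by
    rw [ZMod.intCast_eq_intCast_iff_dvd_sub]
    push_cast
    rw [← dvd_neg, neg_sub]
    exact h
  rw [fold, fold, this]

theorem fold_neg (g : ℕ) (t : ℤ) : fold g (-t) = fold g t := by
  rw [fold, fold, Int.cast_neg, ZMod.natAbs_valMinAbs_neg]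

theorem fold_eq_of_dvd_add {g : ℕ} {s t : ℤ} (h : (2 * g : ℤ) ∣ s + t) : fold g s = fold g t := by
  rw [← fold_neg g t]
  exact fold_eq_of_dvd_sub (by rwa [sub_neg_eq_add])

theorem fold_natAbs (g : ℕ) (t : ℤ) : fold g (t.natAbs : ℤ) = fold g t := by
  rcases Int.natAbs_eq t with h | h
  · rw [← h]
  · conv_rhs => rw [h]
    rw [fold_neg]

theorem fold_of_le {g r : ℕ} (h : r ≤ g) : fold g (r : ℤ) = r := by
  rw [fold, Int.cast_natCast, ZMod.valMinAbs_natCast_of_le_half (by omega), Int.natAbs_natCast]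

theorem fold_le {g : ℕ} (hg : 0 < g) (t : ℤ) : fold g t ≤ g := by
  have : NeZero (2 * g) := ⟨by omega⟩
  have := ZMod.natAbs_valMinAbs_le (t : ZMod (2 * g))
  rw [fold]
  omega

theorem fold_emod_two (g : ℕ) (t : ℤ) : ((fold g t : ℕ) : ℤ) % 2 = t % 2 := by
  have h : (((t : ZMod (2 * g)).valMinAbs : ℤ) : ZMod (2 * g)) = (t : ZMod (2 * g)) :=
    ZMod.coe_valMinAbs _
  rw [ZMod.intCast_eq_intCast_iff_dvd_sub] at h
  obtain ⟨k, hk⟩ := h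
  push_cast at hk
  rw [mul_assoc] at hk
  rw [fold]
  generalize (g : ℤ) * k = q at hk
  omega

/-- A function on `{0, …, m + n - 1}` that is invariant under the reflections in `m` and in `n`
depends only on the distance of the argument to the multiples of `2 * gcd m n`. -/
theorem eq_fold_gcd_of_reflections {α : Type*} (F : ℕ → α) (m n : ℕ) (hm : 0 < m) (hn : 0 < n)
    (h₁ : ∀ y < n, F (m + y) = F ((m : ℤ) - y).natAbs)
    (h₂ : ∀ x < m, F (n + x) = F ((n : ℤ) - x).natAbs) :
    ∀ t < m + n, F t = F (fold (Nat.gcd m n) t) := by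
  suffices H : ∀ N m n : ℕ, m + n = N → 0 < m → 0 < n → m ≤ n →
      (∀ y < n, F (m + y) = F ((m : ℤ) - y).natAbs) →
      (∀ x < m, F (n + x) = F ((n : ℤ) - x).natAbs) →
      ∀ t < m + n, F t = F (fold (Nat.gcd m n) t) by
    rcases le_total m n with h | h
    · exact H _ m n rfl hm hn h h₁ h₂
    · rw [Nat.gcd_comm, add_comm]
      exact H _ n m rfl hn hm h h₂ h₁
  clear! m n
  intro N
  induction N using Nat.strong_induction_on with
  | _ N ih =>
    rintro m n hN hm hn hmn h₁ h₂ t ht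
    rcases hmn.eq_or_lt with rfl | hlt
    · rw [Nat.gcd_self]
      rcases le_or_gt t m with htm | htm
      · rw [fold_of_le htm]
      · have e := h₁ (t - m) (by omega)
        rw [show m + (t - m) = t by omega] at e
        have e2 : fold m t = ((m : ℤ) - (t - m : ℕ)).natAbs := by
          rw [← fold_of_le (show ((m : ℤ) - (t - m : ℕ)).natAbs ≤ m by omega), fold_natAbs]
          exact fold_eq_of_dvd_add ⟨1, by push_cast [htm.le]; ring⟩
        rw [e, e2]
    · have hg : Nat.gcd m (n - m) = Nat.gcd m n := Nat.gcd_sub_self_right hmn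
      have d₁ : ((Nat.gcd m n : ℕ) : ℤ) ∣ m := by exact_mod_cast Nat.gcd_dvd_left m n
      have d₂ : ((Nat.gcd m n : ℕ) : ℤ) ∣ n := by exact_mod_cast Nat.gcd_dvd_right m n
      have s₁ : ∀ y < n - m, F (m + y) = F ((m : ℤ) - y).natAbs := fun y hy => h₁ y (by omega)
      -- One step of Euclid's algorithm: `n - m + x` and `|n - m - x|` are the mirror images of `m +
      -- n - x` in `n` and in `m`. For `x = 0` that point is out of range, but there is nothing to
      -- prove.
      have s₂ : ∀ x < m, F (n - m + x) = F (((n - m : ℕ) : ℤ) - x).natAbs := by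
        intro x hx
        rcases Nat.eq_zero_or_pos x with rfl | hx0
        · congr 1
        · have e₁ := h₂ (m - x) (by omega)
          have e₂ := h₁ (n - x) (by omega)
          rw [show ((n : ℤ) - (m - x : ℕ)).natAbs = n - m + x by omega] at e₁
          rw [← e₁, show n + (m - x) = m + (n - x) by omega, e₂]
          congr 1
          omega
      have key : ∀ t < n, F t = F (fold (Nat.gcd m n) t) := by
        intro t ht
        rcases le_total m (n - m) with h | h
        · rw [← hg]
          exact ih (m + (n - m)) (by omega) m (n - m) rfl hm (by omega) h s₁ s₂ t (by omega)
        · rw [← hg, Nat.gcd_comm]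
          exact ih (n - m + m) (by omega) (n - m) m rfl (by omega) hm h s₂ s₁ t (by omega)
      rcases lt_or_ge t n with htn | htn
      · exact key t htn
      -- The points from `n` on are reflected below `n`. The reflection in `n` fixes `n` itself,
      -- which is therefore reflected in `m`.
      · rcases htn.eq_or_lt with rfl | htn
        · have e := h₁ (n - m) (by omega)
          rw [show m + (n - m) = n by omega] at e
          rw [e, key _ (by omega), fold_natAbs]
          congr 1
          refine fold_eq_of_dvd_add ?_
          rw [show (m : ℤ) - (n - m : ℕ) + n = 2 * m by omega]
          exact mul_dvd_mul_left 2 d₁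
        · have e := h₂ (t - n) (by omega)
          rw [show n + (t - n) = t by omega] at e
          rw [e, key _ (by omega), fold_natAbs]
          congr 1
          refine fold_eq_of_dvd_add ?_
          rw [show (n : ℤ) - (t - n : ℕ) + t = 2 * n by omega]
          exact mul_dvd_mul_left 2 d₂

/-! ### Black diagonals of the unit squares -/

/-- A nonempty grid is connected, so the colour of `(0, 0)` determines all others. The parity `ε` of
the black vertices lets both colourings be treated at once. -/
theorem exists_parity_of_coloring {a b : ℕ} (c : (rectGrid a b).Coloring Bool) :
    ∃ ε < 2, ∀ v : Fin a × Fin b, c v = true ↔ (v.1.val + v.2.val) % 2 = ε := by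
  by_cases h : 0 < a ∧ 0 < b
  · obtain ⟨ha, hb⟩ := h
    have key : ∀ (N : ℕ) (v : Fin a × Fin b), v.1.val + v.2.val = N →
        (c v = true ↔ N % 2 = if c (⟨0, ha⟩, ⟨0, hb⟩) = true then 0 else 1) := by
      intro N
      induction N with
      | zero =>
        rintro ⟨⟨x, hx⟩, ⟨y, hy⟩⟩ h
        obtain ⟨rfl, rfl⟩ : x = 0 ∧ y = 0 := by simp only at h; omega
        split_ifs with h0 <;> simp [h0]
      | succ N ih =>
        rintro ⟨⟨x, hx⟩, ⟨y, hy⟩⟩ h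
        obtain ⟨u, hu, hadj⟩ : ∃ u : Fin a × Fin b, u.1.val + u.2.val = N ∧
            (rectGrid a b).Adj u (⟨x, hx⟩, ⟨y, hy⟩) := by
          rcases Nat.eq_zero_or_pos x with rfl | hx0
          · exact ⟨(⟨0, hx⟩, ⟨y - 1, by omega⟩), by simp only at h ⊢; omega, by
              simp only [SimpleGraph.boxProd_adj, SimpleGraph.pathGraph_adj] at h ⊢; simp; omega⟩
          · exact ⟨(⟨x - 1, by omega⟩, ⟨y, hy⟩), by simp only at h ⊢; omega, by
              simp only [SimpleGraph.boxProd_adj, SimpleGraph.pathGraph_adj] at h ⊢; simp; omega⟩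
        have h1 := ih u hu
        have h2 := c.valid hadj
        rcases Nat.mod_two_eq_zero_or_one N with hN | hN <;>
          rcases Bool.eq_false_or_eq_true (c u) with e | e <;>
          split_ifs at h1 ⊢ <;> simp_all <;> omega
    exact ⟨_, by split_ifs <;> omega, fun v => key _ v rfl⟩
  · refine ⟨0, by omega, fun v => absurd ⟨?_, ?_⟩ h⟩
    · exact v.1.pos
    · exact v.2.pos

/-- The position of the diagonal through the face `(i, j)` whose vertices have parity `ε`. -/
def diagPos (ε i j : ℕ) : ℕ := if (i + j) % 2 = ε then ((i : ℤ) - j).natAbs else i + j + 1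

section Diagonals

variable {α : Type*} {m n ε : ℕ} {B : ℕ → ℕ → α}

/-- In this section `hd` and `ha` compare opposite faces at an internal black vertex; `hl`, `hr`,
`hb`, `ht` compare the two faces at a black vertex on a wall. Corners impose nothing, having one
face only. -/
theorem eq_slide_diagonal
    (hd : ∀ i j, i + 1 < m → j + 1 < n → (i + j) % 2 = ε → B i j = B (i + 1) (j + 1))
    (k i j : ℕ) (hi : i + k < m) (hj : j + k < n) (h : (i + j) % 2 = ε) :
    B i j = B (i + k) (j + k) := by
  induction k with
  | zero => rfl
  | succ k ih =>
    rw [ih (by omega) (by omega), hd (i + k) (j + k) (by omega) (by omega) (by omega)]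
    rfl

theorem eq_slide_antidiagonal
    (ha : ∀ i j, i + 1 < m → j + 1 < n → (i + j) % 2 = ε → B i (j + 1) = B (i + 1) j)
    (hε : ε < 2)
    (k i j : ℕ) (hi : i + k < m) (hj : j + k < n) (h : (i + j + k) % 2 ≠ ε) :
    B i (j + k) = B (i + k) j := by
  induction k generalizing j with
  | zero => rfl
  | succ k ih =>
    have := ih (j + 1) (by omega) (by omega) (by omega)
    rw [show j + (k + 1) = j + 1 + k by omega, this,
      ha (i + k) j (by omega) (by omega) (by omega)]
    rfl

theorem eq_of_antidiagonal_eq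
    (ha : ∀ i j, i + 1 < m → j + 1 < n → (i + j) % 2 = ε → B i (j + 1) = B (i + 1) j)
    (hε : ε < 2) {i j i' j' : ℕ} (hi : i < m) (hj : j < n) (hi' : i' < m) (hj' : j' < n)
    (h : (i + j) % 2 ≠ ε) (e : i + j = i' + j') : B i j = B i' j' := by
  rcases le_total i i' with hle | hle
  · have := eq_slide_antidiagonal ha hε (i' - i) i j' (by omega) (by omega) (by omega)
    rwa [show j' + (i' - i) = j by omega, show i + (i' - i) = i' by omega] at this
  · have := eq_slide_antidiagonal ha hε (i - i') i' j (by omega) (by omega) (by omega)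
    rw [show j + (i - i') = j' by omega, show i' + (i - i') = i by omega] at this
    exact this.symm

/-- A diagonal is followed down to the wall `x = 0` or `y = 0`, where `hl` or `hb` reflects it onto
the antidiagonal with the same position. -/
theorem eq_antidiagonal_of_diagPos
    (hd : ∀ i j, i + 1 < m → j + 1 < n → (i + j) % 2 = ε → B i j = B (i + 1) (j + 1))
    (ha : ∀ i j, i + 1 < m → j + 1 < n → (i + j) % 2 = ε → B i (j + 1) = B (i + 1) j)
    (hl : ∀ j, j + 1 < n → (j + 1) % 2 = ε → B 0 j = B 0 (j + 1))
    (hb : ∀ i, i + 1 < m → (i + 1) % 2 = ε → B i 0 = B (i + 1) 0)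
    (hε : ε < 2) {i j i' j' : ℕ} (hi : i < m) (hj : j < n) (hi' : i' < m) (hj' : j' < n)
    (e : diagPos ε i j = i' + j' + 1) : B i j = B i' j' := by
  rw [diagPos] at e
  split_ifs at e with h
  · rcases le_total i j with hle | hle
    · have h1 := eq_slide_diagonal hd i 0 (j - i) (by omega) (by omega) (by omega)
      rw [show 0 + i = i by omega, show j - i + i = j by omega] at h1
      have h2 := hl (j - i - 1) (by omega) (by omega)
      rw [show j - i - 1 + 1 = j - i by omega] at h2
      rw [← h1, ← h2]
      exact eq_of_antidiagonal_eq ha hε (by omega) (by omega) hi' hj' (by omega) (by omega)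
    · have h1 := eq_slide_diagonal hd j (i - j) 0 (by omega) (by omega) (by omega)
      rw [show 0 + j = j by omega, show i - j + j = i by omega] at h1
      have h2 := hb (i - j - 1) (by omega) (by omega)
      rw [show i - j - 1 + 1 = i - j by omega] at h2
      rw [← h1, ← h2]
      exact eq_of_antidiagonal_eq ha hε (by omega) (by omega) hi' hj' (by omega) (by omega)
  · exact eq_of_antidiagonal_eq ha hε hi hj hi' hj' h (by omega)

theorem eq_of_diagPos_eq
    (hd : ∀ i j, i + 1 < m → j + 1 < n → (i + j) % 2 = ε → B i j = B (i + 1) (j + 1))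
    (ha : ∀ i j, i + 1 < m → j + 1 < n → (i + j) % 2 = ε → B i (j + 1) = B (i + 1) j)
    (hl : ∀ j, j + 1 < n → (j + 1) % 2 = ε → B 0 j = B 0 (j + 1))
    (hb : ∀ i, i + 1 < m → (i + 1) % 2 = ε → B i 0 = B (i + 1) 0)
    (hε : ε < 2) {i j i' j' : ℕ} (hi : i < m) (hj : j < n) (hi' : i' < m) (hj' : j' < n)
    (e : diagPos ε i j = diagPos ε i' j') : B i j = B i' j' := by
  rcases Nat.eq_zero_or_pos (diagPos ε i j) with h0 | hpos
  · have key : ∀ i j, i < m → j < n → diagPos ε i j = 0 → B i j = B 0 0 := by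
      intro i j hi hj h
      rw [diagPos] at h
      split_ifs at h with hp
      have := eq_slide_diagonal hd i 0 0 (by omega) (by omega) (by omega)
      rw [this]
      congr 1 <;> omega
    rw [key i j hi hj h0, key i' j' hi' hj' (by omega)]
  -- `p + q + 1` takes all values `1, …, m + n - 1`, so an antidiagonal face serves as common
  -- reference. Position `0`, the diagonal through the origin, has none and is treated apart.
  · obtain ⟨p, q, hp, hq, hpq⟩ : ∃ p q, p < m ∧ q < n ∧ diagPos ε i j = p + q + 1 := by
      have hlt : diagPos ε i j < m + n := by rw [diagPos]; split_ifs <;> omega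
      rcases lt_or_ge (diagPos ε i j) m with h | h
      · exact ⟨diagPos ε i j - 1, 0, by omega, by omega, by omega⟩
      · exact ⟨m - 1, diagPos ε i j - m, by omega, by omega, by omega⟩
    rw [eq_antidiagonal_of_diagPos hd ha hl hb hε hi hj hp hq hpq,
      eq_antidiagonal_of_diagPos hd ha hl hb hε hi' hj' hp hq (e ▸ hpq)]

theorem eq_of_fold_diagPos_eq
    (hd : ∀ i j, i + 1 < m → j + 1 < n → (i + j) % 2 = ε → B i j = B (i + 1) (j + 1))
    (ha : ∀ i j, i + 1 < m → j + 1 < n → (i + j) % 2 = ε → B i (j + 1) = B (i + 1) j)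
    (hl : ∀ j, j + 1 < n → (j + 1) % 2 = ε → B 0 j = B 0 (j + 1))
    (hr : ∀ j, j + 1 < n → (m + (j + 1)) % 2 = ε → B (m - 1) j = B (m - 1) (j + 1))
    (hb : ∀ i, i + 1 < m → (i + 1) % 2 = ε → B i 0 = B (i + 1) 0)
    (ht : ∀ i, i + 1 < m → (n + (i + 1)) % 2 = ε → B i (n - 1) = B (i + 1) (n - 1))
    (hε : ε < 2) {i j i' j' : ℕ} (hi : i < m) (hj : j < n) (hi' : i' < m) (hj' : j' < n)
    (e : fold (Nat.gcd m n) (diagPos ε i j) = fold (Nat.gcd m n) (diagPos ε i' j')) :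
    B i j = B i' j' := by
  classical
  -- `B` as a function of the position, well defined by `eq_of_diagPos_eq`. Unattained positions,
  -- among them all of the wrong parity, get the constant `B 0 0`, so the reflections hold there
  -- trivially.
  let F : ℕ → α := fun t =>
    if h : ∃ p : ℕ × ℕ, p.1 < m ∧ p.2 < n ∧ diagPos ε p.1 p.2 = t then B h.choose.1 h.choose.2
    else B 0 0
  have hF : ∀ p q, p < m → q < n → F (diagPos ε p q) = B p q := by
    intro p q hp hq
    have h : ∃ p' : ℕ × ℕ, p'.1 < m ∧ p'.2 < n ∧ diagPos ε p'.1 p'.2 = diagPos ε p q :=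
      ⟨(p, q), hp, hq, rfl⟩
    simp only [F, dif_pos h]
    exact eq_of_diagPos_eq hd ha hl hb hε h.choose_spec.1 h.choose_spec.2.1 hp hq
      h.choose_spec.2.2
  have hmod : ∀ p q, diagPos ε p q % 2 = ε := by
    intro p q
    rw [diagPos]
    split_ifs <;> omega
  have hF0 : ∀ t, t % 2 ≠ ε → F t = B 0 0 := by
    intro t ht
    have h : ¬ ∃ p : ℕ × ℕ, p.1 < m ∧ p.2 < n ∧ diagPos ε p.1 p.2 = t := by
      rintro ⟨p, -, -, hp⟩
      exact ht (hp ▸ hmod _ _)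
    simp only [F, dif_neg h]
  -- The faces `(m - 1, y)` and `(m - 1, y - 1)` meet at the wall vertex `(m, y)`; their positions
  -- are `m + y` and `|m - y|`.
  have r₁ : ∀ y < n, F (m + y) = F ((m : ℤ) - y).natAbs := by
    intro y hy
    rcases Nat.eq_zero_or_pos y with rfl | hy0
    · congr 1
    by_cases hp : (m + y) % 2 = ε
    · have e₁ := hF (m - 1) y (by omega) hy
      have e₂ := hF (m - 1) (y - 1) (by omega) (by omega)
      have e₃ := hr (y - 1) (by omega) (by omega)
      rw [diagPos, if_neg (by omega)] at e₁
      rw [diagPos, if_pos (by omega)] at e₂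
      rw [show m - 1 + y + 1 = m + y by omega] at e₁
      rw [show (((m - 1 : ℕ) : ℤ) - (y - 1 : ℕ)).natAbs = ((m : ℤ) - y).natAbs by omega] at e₂
      rw [e₁, e₂, e₃, Nat.sub_add_cancel hy0]
    · rw [hF0 _ hp, hF0 _ (by omega)]
  have r₂ : ∀ x < m, F (n + x) = F ((n : ℤ) - x).natAbs := by
    intro x hx
    rcases Nat.eq_zero_or_pos x with rfl | hx0
    · congr 1
    by_cases hp : (n + x) % 2 = ε
    · have e₁ := hF x (n - 1) hx (by omega)
      have e₂ := hF (x - 1) (n - 1) (by omega) (by omega)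
      have e₃ := ht (x - 1) (by omega) (by omega)
      rw [diagPos, if_neg (by omega)] at e₁
      rw [diagPos, if_pos (by omega)] at e₂
      rw [show x + (n - 1) + 1 = n + x by omega] at e₁
      rw [show (((x - 1 : ℕ) : ℤ) - (n - 1 : ℕ)).natAbs = ((n : ℤ) - x).natAbs by omega] at e₂
      rw [e₁, e₂, e₃, Nat.sub_add_cancel hx0]
    · rw [hF0 _ hp, hF0 _ (by omega)]
  have hlt : ∀ p q, p < m → q < n → diagPos ε p q < m + n := by
    intro p q hp hq
    rw [diagPos]
    split_ifs <;> omega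
  have key := eq_fold_gcd_of_reflections F m n (by omega) (by omega) r₁ r₂
  rw [← hF i j hi hj, ← hF i' j' hi' hj', key _ (hlt i j hi hj), key _ (hlt i' j' hi' hj'), e]

end Diagonals

/-! ### Billiard nests and the path basis -/

section BilliardNests

variable {m n : ℕ}

/-- At a wall the sum or the difference of `x - y` and `x + y` is `0`, `2 * m` or `-2 * n`, a
multiple of `2 * gcd m n`: reflection does not change the invariant. -/
theorem fold_sub_eq_fold_add_of_isExternal {b : Fin (m + 1) × Fin (n + 1)} (h : IsExternal b) :
    fold (Nat.gcd m n) ((b.1.val : ℤ) - b.2.val) = fold (Nat.gcd m n) ((b.1.val : ℤ) + b.2.val) := by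
  have d₁ : ((Nat.gcd m n : ℕ) : ℤ) ∣ m := by exact_mod_cast Nat.gcd_dvd_left m n
  have d₂ : ((Nat.gcd m n : ℕ) : ℤ) ∣ n := by exact_mod_cast Nat.gcd_dvd_right m n
  rcases h with h | h | h | h
  · exact fold_eq_of_dvd_add ⟨0, by rw [h]; push_cast; ring⟩
  · refine fold_eq_of_dvd_add ?_
    rw [h, show (m : ℤ) - b.2.val + (m + b.2.val) = 2 * m by ring]
    exact mul_dvd_mul_left 2 d₁
  · exact fold_eq_of_dvd_sub ⟨0, by rw [h]; push_cast; ring⟩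
  · refine fold_eq_of_dvd_sub ?_
    rw [h, show (b.1.val : ℤ) - n - (b.1.val + n) = 2 * (-n) by ring]
    exact mul_dvd_mul_left 2 (dvd_neg.2 d₂)

/-- At a black vertex the faces in even quadrants have their black diagonal on the line `x - y`
constant, those in odd quadrants on `x + y` constant. -/
theorem fold_diagPos_of_faceAt {ε : ℕ} (g : ℕ) {b : Fin (m + 1) × Fin (n + 1)}
    (hb : (b.1.val + b.2.val) % 2 = ε) {k : Fin 4} {f : Face m n} (h : FaceAt b k f) :
    fold g (diagPos ε f.1.val f.2.val) =
      if Even k.val then fold g ((b.1.val : ℤ) - b.2.val) else fold g ((b.1.val : ℤ) + b.2.val) := by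
  fin_cases k <;> simp only [FaceAt] at h <;> rw [diagPos]
  · rw [if_pos (by omega), if_pos (by decide), fold_natAbs]
    congr 1; omega
  · rw [if_neg (by omega), if_neg (by decide)]
    congr 1; omega
  · rw [if_pos (by omega), if_pos (by decide), fold_natAbs]
    congr 1; omega
  · rw [if_neg (by omega), if_neg (by decide)]
    congr 1; omega

/-- Two faces are linked at the black vertex `b` if they are opposite at the internal vertex `b`, or
incident to the external vertex `b`. -/
def Linked (b : Fin (m + 1) × Fin (n + 1)) (f f' : Face m n) : Prop :=
  (¬ IsExternal b ∧ ∃ k k' : Fin 4, FaceAt b k f ∧ FaceAt b k' f' ∧ Even (k.val + k'.val)) ∨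
    (IsExternal b ∧ Incident b f ∧ Incident b f')

theorem Linked.symm {b : Fin (m + 1) × Fin (n + 1)} {f f' : Face m n} (h : Linked b f f') :
    Linked b f' f := by
  rcases h with ⟨h, k, k', hk, hk', e⟩ | ⟨h, h₁, h₂⟩
  · exact Or.inl ⟨h, k', k, hk', hk, by rwa [add_comm]⟩
  · exact Or.inr ⟨h, h₂, h₁⟩

variable (c : (rectGrid (m + 1) (n + 1)).Coloring Bool)

theorem billiardGraph_adj {f f' : Face m n} :
    (billiardGraph c).Adj f f' ↔ f ≠ f' ∧ ∃ b, c b = true ∧ Linked b f f' := by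
  rw [billiardGraph, SimpleGraph.fromRel_adj]
  refine and_congr_right fun _ => ⟨?_, fun h => Or.inl h⟩
  rintro (h | ⟨b, hb, h⟩)
  · exact h
  · exact ⟨b, hb, Linked.symm h⟩

theorem fold_diagPos_of_linked {ε : ℕ} {b : Fin (m + 1) × Fin (n + 1)}
    (hb : (b.1.val + b.2.val) % 2 = ε) {f f' : Face m n} (h : Linked b f f') :
    fold (Nat.gcd m n) (diagPos ε f.1.val f.2.val) =
      fold (Nat.gcd m n) (diagPos ε f'.1.val f'.2.val) := by
  rcases h with ⟨-, k, k', hk, hk', e⟩ | ⟨hE, ⟨k, hk⟩, ⟨k', hk'⟩⟩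
  · rw [fold_diagPos_of_faceAt _ hb hk, fold_diagPos_of_faceAt _ hb hk']
    rw [Nat.even_add] at e
    simp only [e]
  · rw [fold_diagPos_of_faceAt _ hb hk, fold_diagPos_of_faceAt _ hb hk', fold_sub_eq_fold_add_of_isExternal hE]
    split_ifs <;> rfl

theorem connectedComponentMk_eq_of_linked {b : Fin (m + 1) × Fin (n + 1)} (hb : c b = true)
    {f f' : Face m n} (h : Linked b f f') :
    (billiardGraph c).connectedComponentMk f = (billiardGraph c).connectedComponentMk f' := by
  by_cases hf : f = f'
  · rw [hf]
  · exact SimpleGraph.ConnectedComponent.sound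
      (SimpleGraph.Adj.reachable ((billiardGraph_adj c).2 ⟨hf, b, hb, h⟩))

theorem mem_iff_of_connectedComponentMk_eq {B : Set (Face m n)}
    (hB : ∀ f f', (billiardGraph c).Adj f f' → (f ∈ B ↔ f' ∈ B)) {f f' : Face m n}
    (h : (billiardGraph c).connectedComponentMk f = (billiardGraph c).connectedComponentMk f') :
    f ∈ B ↔ f' ∈ B := by
  obtain ⟨w⟩ := SimpleGraph.ConnectedComponent.exact h
  induction w with
  | nil => rfl
  | cons hadj w ih =>
    exact (hB _ _ hadj).trans (ih (SimpleGraph.ConnectedComponent.sound ⟨w⟩))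

/-- The four alternatives at an internal vertex are the four ways to decide membership separately
for the even and for the odd quadrants, which is what the links leave open. -/
theorem isBilliardNest_iff {B : Set (Face m n)} :
    IsBilliardNest c B ↔ ∀ f f', (billiardGraph c).Adj f f' → (f ∈ B ↔ f' ∈ B) := by
  constructor
  · intro hB f f' hadj
    obtain ⟨-, b, hb, ⟨hI, k, k', hk, hk', e⟩ | ⟨hE, hf, hf'⟩⟩ := (billiardGraph_adj c).1 hadj
    · rw [Nat.even_add] at e
      rcases (hB b hb).1 hI with h | h | h | h
      · exact iff_of_true (h _ ⟨k, hk⟩) (h _ ⟨k', hk'⟩)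
      · exact iff_of_false (h _ ⟨k, hk⟩) (h _ ⟨k', hk'⟩)
      · rw [h k f hk, h k' f' hk', e]
      · rw [h k f hk, h k' f' hk', ← Nat.not_even_iff_odd, ← Nat.not_even_iff_odd, e]
    · rcases (hB b hb).2 hE with h | h
      · exact iff_of_true (h _ hf) (h _ hf')
      · exact iff_of_false (h _ hf) (h _ hf')
  · intro hB b hb
    have link : ∀ f f', Linked b f f' → (f ∈ B ↔ f' ∈ B) := fun f f' h =>
      mem_iff_of_connectedComponentMk_eq c hB (connectedComponentMk_eq_of_linked c hb h)
    refine ⟨fun hI => ?_, fun hE => ?_⟩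
    · have hI' := hI
      rw [IsExternal] at hI'
      push Not at hI'
      obtain ⟨⟨x, hx⟩, ⟨y, hy⟩⟩ := b
      simp only at hI'
      let f₀ : Face m n := (⟨x, by omega⟩, ⟨y, by omega⟩)
      let f₁ : Face m n := (⟨x - 1, by omega⟩, ⟨y, by omega⟩)
      have h₀ : FaceAt (⟨x, hx⟩, ⟨y, hy⟩) 0 f₀ := ⟨rfl, rfl⟩
      have h₁ : FaceAt (⟨x, hx⟩, ⟨y, hy⟩) 1 f₁ := ⟨by simp only [f₁]; omega, rfl⟩
      have key : ∀ (k : Fin 4) f, FaceAt (⟨x, hx⟩, ⟨y, hy⟩) k f →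
          (f ∈ B ↔ if Even k.val then f₀ ∈ B else f₁ ∈ B) := by
        intro k f hk
        split_ifs with e
        · exact link f f₀ (Or.inl ⟨hI, k, 0, hk, h₀, by simpa using e⟩)
        · refine link f f₁ (Or.inl ⟨hI, k, 1, hk, h₁, ?_⟩)
          rw [Nat.even_add]
          exact iff_of_false e (by decide)
      by_cases m₀ : f₀ ∈ B <;> by_cases m₁ : f₁ ∈ B
      · exact Or.inl fun f ⟨k, hk⟩ => by rw [key k f hk]; simp [m₀, m₁]
      · exact Or.inr (Or.inr (Or.inl fun k f hk => by rw [key k f hk]; simp [m₀, m₁]))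
      · exact Or.inr (Or.inr (Or.inr fun k f hk => by
          rw [key k f hk, ← Nat.not_even_iff_odd]; simp [m₀, m₁]))
      · exact Or.inr (Or.inl fun f ⟨k, hk⟩ => by rw [key k f hk]; simp [m₀, m₁])
    · by_cases h : ∃ f, Incident b f ∧ f ∈ B
      · obtain ⟨f, hf, hfB⟩ := h
        exact Or.inl fun f' hf' => (link f f' (Or.inr ⟨hE, hf, hf'⟩)).1 hfB
      · push Not at h
        exact Or.inr h

theorem pathBasis_eq_range :
    pathBasis c = Set.range (SimpleGraph.ConnectedComponent.supp (G := billiardGraph c)) := by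
  ext P
  simp only [pathBasis, Set.mem_ofPred_eq, Set.mem_range, eq_comm]

theorem faceVec_supp_apply (K : (billiardGraph c).ConnectedComponent) (f : Face m n)
    [Decidable ((billiardGraph c).connectedComponentMk f = K)] :
    faceVec K.supp f = if (billiardGraph c).connectedComponentMk f = K then 1 else 0 := by
  classical
  rw [faceVec, Set.indicator_apply]
  simp only [SimpleGraph.ConnectedComponent.mem_supp_iff, Pi.one_apply]

/-- Components are disjoint and nonempty: evaluating at a face isolates the coefficient of its
component. -/
theorem linearIndepOn_pathBasis : LinearIndepOn (ZMod 2) faceVec (pathBasis c) := by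
  classical
  have := Fintype.ofFinite (billiardGraph c).ConnectedComponent
  rw [pathBasis_eq_range,
    linearIndepOn_range_iff SimpleGraph.ConnectedComponent.supp_injective,
    Fintype.linearIndependent_iff]
  intro v hv K
  obtain ⟨f, rfl⟩ := K.exists_rep
  have := congrFun hv f
  rw [Finset.sum_apply] at this
  simp only [Function.comp_apply, Pi.smul_apply, faceVec_supp_apply, smul_eq_mul, mul_ite, mul_one,
    mul_zero, Finset.sum_ite_eq, Finset.mem_univ, if_true, Pi.zero_apply] at this
  exact this

/-- Both sides are the functions constant on components; the coefficient of a component is the value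
at any of its faces. -/
theorem span_pathBasis :
    (Submodule.span (ZMod 2) (faceVec '' pathBasis c) : Set (Face m n → ZMod 2)) =
      faceVec '' {B | IsBilliardNest c B} := by
  classical
  have := Fintype.ofFinite (billiardGraph c).ConnectedComponent
  apply Set.Subset.antisymm
  · intro v hv
    have hconst : ∀ f f', (billiardGraph c).Adj f f' → v f = v f' := by
      intro f f' hadj
      induction hv using Submodule.span_induction with
      | mem v hv =>
        rw [pathBasis_eq_range] at hv
        obtain ⟨_, ⟨K, rfl⟩, rfl⟩ := hv
        rw [faceVec_supp_apply, faceVec_supp_apply,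
          SimpleGraph.ConnectedComponent.sound hadj.reachable]
      | zero => rfl
      | add v w _ _ hv hw => rw [Pi.add_apply, Pi.add_apply, hv, hw]
      | smul a v _ hv => rw [Pi.smul_apply, Pi.smul_apply, hv]
    refine ⟨{f | v f = 1}, (isBilliardNest_iff c).2 fun f f' hadj => ?_, ?_⟩
    · simp only [Set.mem_ofPred_eq, hconst f f' hadj]
    · ext f
      rw [faceVec, Set.indicator_apply]
      have : ∀ a : ZMod 2, (if a = 1 then 1 else 0) = a := by decide
      exact this (v f)
  · rintro _ ⟨B, hB, rfl⟩
    have hB' := (isBilliardNest_iff c).1 hB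
    have : faceVec B = ∑ K : (billiardGraph c).ConnectedComponent,
        faceVec B K.out • faceVec K.supp := by
      ext f
      rw [Finset.sum_apply]
      simp only [Pi.smul_apply, faceVec_supp_apply, smul_eq_mul, mul_ite, mul_one, mul_zero,
        Finset.sum_ite_eq, Finset.mem_univ, if_true]
      have hf := mem_iff_of_connectedComponentMk_eq c hB'
        (f := ((billiardGraph c).connectedComponentMk f).out) (f' := f) (Quot.out_eq _)
      rw [faceVec, Set.indicator_apply, Set.indicator_apply]
      simp only [hf, Pi.one_apply]
    rw [this]
    refine Submodule.sum_mem _ fun K _ => Submodule.smul_mem _ _ (Submodule.subset_span ⟨_, ?_, rfl⟩)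
    exact ⟨K, rfl⟩

/-- For odd `g` both parities are equally frequent in `0, …, g`, so the answer does not depend on
the colouring. -/
theorem ncard_parity_class {g ε : ℕ} (hg : Odd g) (hε : ε < 2) :
    2 * {r : ℕ | r ≤ g ∧ r % 2 = ε}.ncard = g + 1 := by
  obtain ⟨k, rfl⟩ := hg
  have : {r : ℕ | r ≤ 2 * k + 1 ∧ r % 2 = ε} =
      (((Finset.range (k + 1)).image fun i => 2 * i + ε : Finset ℕ) : Set ℕ) := by
    ext r
    simp only [Set.mem_ofPred_eq, Finset.coe_image, Finset.coe_range, Set.mem_image, Set.mem_Iio]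
    constructor
    · rintro ⟨h₁, h₂⟩
      exact ⟨r / 2, by omega, by omega⟩
    · rintro ⟨i, hi, rfl⟩
      omega
  rw [this, Set.ncard_coe_finset, Finset.card_image_of_injective _ (fun a b h => by
    have h' : 2 * a + ε = 2 * b + ε := h
    omega), Finset.card_range]
  ring

/-- `fold` of the position identifies the components with the integers in `0, …, gcd m n` of parity
`ε`. -/
theorem ncard_pathBasis (hm : 1 ≤ m) (hn : 1 ≤ n) (hg : Odd (Nat.gcd m n)) :
    2 * (pathBasis c).ncard = Nat.gcd m n + 1 := by
  obtain ⟨ε, hε, hc⟩ := exists_parity_of_coloring c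
  have hpos : 0 < Nat.gcd m n := hg.pos
  let Φ : Face m n → ℕ := fun f => fold (Nat.gcd m n) (diagPos ε f.1.val f.2.val)
  have hΦ : ∀ f f', (billiardGraph c).Adj f f' → Φ f = Φ f' := by
    intro f f' hadj
    obtain ⟨-, b, hb, h⟩ := (billiardGraph_adj c).1 hadj
    exact fold_diagPos_of_linked ((hc b).1 hb) h
  have hwalk : ∀ f f', (billiardGraph c).Walk f f' → Φ f = Φ f' := by
    intro f f' w
    induction w with
    | nil => rfl
    | cons hadj w ih => exact (hΦ _ _ hadj).trans ih
  let Ψ : (billiardGraph c).ConnectedComponent → ℕ :=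
    SimpleGraph.ConnectedComponent.lift Φ fun f f' w _ => hwalk f f' w
  have hΨ : ∀ f, Ψ ((billiardGraph c).connectedComponentMk f) = Φ f := fun f => rfl
  have hinj : Function.Injective Ψ := by
    intro K K' h
    obtain ⟨⟨⟨i, hi⟩, ⟨j, hj⟩⟩, rfl⟩ := K.exists_rep
    obtain ⟨⟨⟨i', hi'⟩, ⟨j', hj'⟩⟩, rfl⟩ := K'.exists_rep
    -- `eq_of_fold_diagPos_eq` is applied to the map sending a face to its own component; the values
    -- outside the rectangle are irrelevant.
    let B : ℕ → ℕ → (billiardGraph c).ConnectedComponent := fun i j =>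
      if h : i < m ∧ j < n then (billiardGraph c).connectedComponentMk (⟨i, h.1⟩, ⟨j, h.2⟩)
      else (billiardGraph c).connectedComponentMk (⟨0, hm⟩, ⟨0, hn⟩)
    have hBeq : ∀ i j (hi : i < m) (hj : j < n),
        B i j = (billiardGraph c).connectedComponentMk (⟨i, hi⟩, ⟨j, hj⟩) :=
      fun i j hi hj => dif_pos ⟨hi, hj⟩
    have hint : ∀ i j i' j' x y, i < m → j < n → i' < m → j' < n →
        ∀ (hx : x < m + 1) (hy : y < n + 1), (x + y) % 2 = ε →
        (0 < x ∧ x < m ∧ 0 < y ∧ y < n) →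
        (i = x ∧ j = y ∧ i' + 1 = x ∧ j' + 1 = y ∨ i + 1 = x ∧ j = y ∧ i' = x ∧ j' + 1 = y) →
        B i j = B i' j' := by
      intro i j i' j' x y hi hj hi' hj' hx hy hp hI h
      rw [hBeq i j hi hj, hBeq i' j' hi' hj']
      apply connectedComponentMk_eq_of_linked c (b := (⟨x, hx⟩, ⟨y, hy⟩)) ((hc _).2 hp)
      refine Or.inl ⟨by rw [IsExternal]; simp only; omega, ?_⟩
      rcases h with ⟨h₁, h₂, h₃, h₄⟩ | ⟨h₁, h₂, h₃, h₄⟩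
      · exact ⟨0, 2, ⟨h₁, h₂⟩, ⟨h₃, h₄⟩, by decide⟩
      · exact ⟨1, 3, ⟨h₁, h₂⟩, ⟨h₃, h₄⟩, by decide⟩
    have hinc : ∀ i j x y (hi : i < m) (hj : j < n) (hx : x < m + 1) (hy : y < n + 1),
        (i = x ∨ i + 1 = x) → (j = y ∨ j + 1 = y) →
        Incident (m := m) (n := n) (⟨x, hx⟩, ⟨y, hy⟩) (⟨i, hi⟩, ⟨j, hj⟩) := by
      rintro i j x y hi hj hx hy (h₁ | h₁) (h₂ | h₂)
      · exact ⟨0, h₁, h₂⟩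
      · exact ⟨3, h₁, h₂⟩
      · exact ⟨1, h₁, h₂⟩
      · exact ⟨2, h₁, h₂⟩
    have hext : ∀ i j i' j' x y, i < m → j < n → i' < m → j' < n →
        ∀ (hx : x < m + 1) (hy : y < n + 1), (x + y) % 2 = ε →
        (x = 0 ∨ x = m ∨ y = 0 ∨ y = n) →
        (i = x ∨ i + 1 = x) → (j = y ∨ j + 1 = y) → (i' = x ∨ i' + 1 = x) →
        (j' = y ∨ j' + 1 = y) → B i j = B i' j' := by
      intro i j i' j' x y hi hj hi' hj' hx hy hp hE h₁ h₂ h₃ h₄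
      rw [hBeq i j hi hj, hBeq i' j' hi' hj']
      apply connectedComponentMk_eq_of_linked c (b := (⟨x, hx⟩, ⟨y, hy⟩)) ((hc _).2 hp)
      exact Or.inr ⟨hE, hinc _ _ _ _ _ _ _ _ h₁ h₂, hinc _ _ _ _ _ _ _ _ h₃ h₄⟩
    have key := eq_of_fold_diagPos_eq (B := B) (m := m) (n := n) (ε := ε)
      (fun i j hi hj h => (hint (i + 1) (j + 1) i j (i + 1) (j + 1) (by omega) (by omega)
        (by omega) (by omega) (by omega) (by omega) (by omega) (by omega) (by omega)).symm)
      (fun i j hi hj h => hint i (j + 1) (i + 1) j (i + 1) (j + 1) (by omega) (by omega)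
        (by omega) (by omega) (by omega) (by omega) (by omega) (by omega) (by omega))
      (fun j hj h => hext 0 j 0 (j + 1) 0 (j + 1) (by omega) (by omega) (by omega) (by omega)
        (by omega) (by omega) (by omega) (by omega) (by omega) (by omega) (by omega) (by omega))
      (fun j hj h => hext (m - 1) j (m - 1) (j + 1) m (j + 1) (by omega) (by omega) (by omega)
        (by omega) (by omega) (by omega) (by omega) (by omega) (by omega) (by omega) (by omega)
        (by omega))
      (fun i hi h => hext i 0 (i + 1) 0 (i + 1) 0 (by omega) (by omega) (by omega) (by omega)
        (by omega) (by omega) (by omega) (by omega) (by omega) (by omega) (by omega) (by omega))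
      (fun i hi h => hext i (n - 1) (i + 1) (n - 1) (i + 1) n (by omega) (by omega) (by omega)
        (by omega) (by omega) (by omega) (by omega) (by omega) (by omega) (by omega) (by omega)
        (by omega))
      hε hi hj hi' hj' h
    rwa [hBeq i j hi hj, hBeq i' j' hi' hj'] at key
  have hrange : Set.range Ψ = {r : ℕ | r ≤ Nat.gcd m n ∧ r % 2 = ε} := by
    ext r
    constructor
    · rintro ⟨K, rfl⟩
      obtain ⟨f, rfl⟩ := K.exists_rep
      refine ⟨fold_le hpos _, ?_⟩
      have h₁ : Φ f % 2 = diagPos ε f.1.val f.2.val % 2 := by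
        have := fold_emod_two (Nat.gcd m n) (diagPos ε f.1.val f.2.val)
        simp only [Φ]
        omega
      have h₂ : diagPos ε f.1.val f.2.val % 2 = ε := by
        rw [diagPos]
        split_ifs <;> omega
      exact h₁.trans h₂
    · rintro ⟨hr, hp⟩
      have hgm : Nat.gcd m n ≤ m := Nat.gcd_le_left n hm
      -- The face `(r - 1, 0)` lies on the antidiagonal at position `r`. For `r = 0` truncated
      -- subtraction gives `(0, 0)`, whose position is `0` since then `ε = 0`.
      refine ⟨(billiardGraph c).connectedComponentMk (⟨r - 1, by omega⟩, ⟨0, hn⟩), ?_⟩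
      rw [hΨ]
      have : diagPos ε (r - 1) 0 = r := by
        rw [diagPos]
        split_ifs <;> omega
      simp only [Φ, this]
      exact fold_of_le hr
  have e₁ : (pathBasis c).ncard = Nat.card (billiardGraph c).ConnectedComponent := by
    rw [pathBasis_eq_range, ← Nat.card_coe_set_eq,
      Nat.card_range_of_injective SimpleGraph.ConnectedComponent.supp_injective]
  rw [e₁, ← Nat.card_range_of_injective hinj, Nat.card_coe_set_eq, hrange,
    ncard_parity_class hg hε]

end BilliardNests

/-! ### Black channels and the wave equation modulo 2 -/

open Classical in
/-- The vectors over `ℤ/2ℤ` that are supported on the black vertices and annihilated by the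
adjacency matrix. -/
noncomputable def blackKernel {V : Type*} [Fintype V] (G : SimpleGraph V) (c : G.Coloring Bool) :
    Submodule (ZMod 2) (V → ZMod 2) where
  carrier := {f | (∀ v, ∑ w, (if G.Adj v w then f w else 0) = 0) ∧ ∀ v, c v ≠ true → f v = 0}
  zero_mem' := by simp
  add_mem' := by
    rintro f f' ⟨h₁, h₂⟩ ⟨h₁', h₂'⟩
    refine ⟨fun v => ?_, fun v hv => by rw [Pi.add_apply, h₂ v hv, h₂' v hv, add_zero]⟩
    have : ∀ w, (if G.Adj v w then (f + f') w else 0) =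
        (if G.Adj v w then f w else 0) + (if G.Adj v w then f' w else 0) := by
      intro w
      split_ifs <;> simp
    rw [Finset.sum_congr rfl fun w _ => this w, Finset.sum_add_distrib, h₁, h₁', add_zero]
  smul_mem' := by
    rintro a f ⟨h₁, h₂⟩
    refine ⟨fun v => ?_, fun v hv => by rw [Pi.smul_apply, h₂ v hv, smul_zero]⟩
    have : ∀ w, (if G.Adj v w then (a • f) w else 0) = a • (if G.Adj v w then f w else 0) := by
      intro w
      split_ifs <;> simp
    rw [Finset.sum_congr rfl fun w _ => this w, ← Finset.smul_sum, h₁, smul_zero]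

open Classical in
theorem mem_blackKernel {V : Type*} [Fintype V] {G : SimpleGraph V} {c : G.Coloring Bool}
    {f : V → ZMod 2} : f ∈ blackKernel G c ↔
      (∀ v, ∑ w, (if G.Adj v w then f w else 0) = 0) ∧ ∀ v, c v ≠ true → f v = 0 :=
  Iff.rfl

theorem ncard_blackChannels {V : Type*} [Fintype V] (G : SimpleGraph V) (c : G.Coloring Bool) :
    (blackChannels G c).ncard = Nat.card (blackKernel G c) := by
  classical
  have hval : ∀ a : ZMod 2, (if a = 1 then 1 else 0) = a := by decide
  have himage : blackChannels G c =
      (fun f : V → ZMod 2 => {v | f v = 1}) '' (blackKernel G c : Set (V → ZMod 2)) := by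
    have hsum : ∀ (C : Set V) v, ((G.neighborSet v ∩ C).ncard : ZMod 2) =
        ∑ w, (if G.Adj v w then C.indicator 1 w else 0) := by
      intro C v
      rw [Set.ncard_eq_toFinset_card', Finset.cast_card, ← Finset.sum_filter]
      simp only [Set.indicator_apply, Pi.one_apply, ← Finset.sum_filter, Finset.filter_filter]
      refine Finset.sum_congr ?_ fun _ _ => rfl
      ext w
      simp
    ext C
    constructor
    · rintro ⟨h₁, h₂⟩
      refine ⟨C.indicator 1, ⟨fun v => ?_, fun v hv => ?_⟩, ?_⟩
      · rw [← hsum, ZMod.natCast_eq_zero_iff_even]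
        exact h₁ v
      · exact Set.indicator_of_notMem (fun h => hv (h₂ v h)) _
      · ext v
        simp [Set.indicator_apply]
    · rintro ⟨f, ⟨h₁, h₂⟩, rfl⟩
      have hf : Set.indicator {v | f v = 1} 1 = f := by
        ext v
        rw [Set.indicator_apply]
        exact hval (f v)
      refine ⟨fun v => ?_, fun v hv => ?_⟩
      · rw [← ZMod.natCast_eq_zero_iff_even, hsum]
        simp only [hf]
        exact h₁ v
      · by_contra h
        have h0 := h₂ v h
        rw [show f v = 1 from hv] at h0
        exact one_ne_zero h0
  rw [himage, Set.ncard_image_of_injective]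
  · rfl
  · intro f f' h
    ext v
    have : f v = 1 ↔ f' v = 1 := Set.ext_iff.1 h v
    rw [← hval (f v), ← hval (f' v)]
    simp only [this]

-- With the vertices shifted to `1, …, b`, zeros at `0` and `b + 1` stand in for the missing
-- neighbours, so endpoints need no separate formula.
open Classical in
theorem sum_pathGraph_adj {M : Type*} [AddCommMonoid M] {b : ℕ} (u : ℕ → M) (h0 : u 0 = 0)
    (hb : u (b + 1) = 0) (i : Fin b) :
    ∑ j : Fin b, (if (SimpleGraph.pathGraph b).Adj i j then u (j.val + 1) else 0) =
      u (i.val + 2) + u i.val := by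
  obtain ⟨i, hi⟩ := i
  have : ∀ j : Fin b, (if (SimpleGraph.pathGraph b).Adj ⟨i, hi⟩ j then u (j.val + 1) else 0) =
      (if j.val = i + 1 then u (j.val + 1) else 0) + (if j.val + 1 = i then u (j.val + 1) else 0) := by
    intro j
    simp only [SimpleGraph.pathGraph_adj]
    by_cases h₁ : j.val = i + 1
    · rw [if_pos (Or.inl h₁.symm), if_pos h₁, if_neg (by omega), add_zero]
    · by_cases h₂ : j.val + 1 = i
      · rw [if_pos (Or.inr h₂), if_neg h₁, if_pos h₂, zero_add]
      · rw [if_neg (by omega), if_neg h₁, if_neg h₂, add_zero]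
  rw [Finset.sum_congr rfl fun j _ => this j, Finset.sum_add_distrib]
  congr 1
  · rcases lt_or_ge (i + 1) b with h | h
    · rw [Finset.sum_eq_single ⟨i + 1, h⟩]
      · simp
      · intro j _ hj
        rw [if_neg]
        exact fun e => hj (Fin.ext e)
      · simp
    · rw [show i + 2 = b + 1 by omega, hb]
      refine Finset.sum_eq_zero fun j _ => if_neg ?_
      omega
  · rcases Nat.eq_zero_or_pos i with rfl | h
    · rw [h0]
      exact Finset.sum_eq_zero fun j _ => if_neg (by omega)
    · rw [Finset.sum_eq_single ⟨i - 1, by omega⟩]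
      · simp only [Nat.sub_add_cancel h, if_true]
      · intro j _ hj
        rw [if_neg]
        exact fun e => hj (Fin.ext (by simp only; omega))
      · simp

open Classical in
theorem sum_rectGrid_adj {M : Type*} [AddCommMonoid M] {a b : ℕ} (u : ℕ → ℕ → M)
    (h₁ : ∀ y ≤ b, u 0 y = 0) (h₂ : ∀ y ≤ b, u (a + 1) y = 0) (h₃ : ∀ x ≤ a, u x 0 = 0)
    (h₄ : ∀ x ≤ a, u x (b + 1) = 0) (v : Fin a × Fin b) :
    ∑ w : Fin a × Fin b, (if (rectGrid a b).Adj v w then u (w.1.val + 1) (w.2.val + 1) else 0) =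
      (u (v.1.val + 2) (v.2.val + 1) + u v.1.val (v.2.val + 1)) +
        (u (v.1.val + 1) (v.2.val + 2) + u (v.1.val + 1) v.2.val) := by
  obtain ⟨x, y⟩ := v
  have : ∀ w : Fin a × Fin b,
      (if (rectGrid a b).Adj (x, y) w then u (w.1.val + 1) (w.2.val + 1) else 0) =
      (if y = w.2 then
        (if (SimpleGraph.pathGraph a).Adj x w.1 then u (w.1.val + 1) (y.val + 1) else 0) else 0) +
      (if x = w.1 then
        (if (SimpleGraph.pathGraph b).Adj y w.2 then u (x.val + 1) (w.2.val + 1) else 0) else 0) := by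
    rintro ⟨x', y'⟩
    simp only [SimpleGraph.boxProd_adj]
    by_cases e₁ : y = y' <;> by_cases e₂ : x = x'
    · subst e₁ e₂
      simp
    · subst e₁
      simp [e₂]
    · subst e₂
      simp [e₁]
    · simp [e₁, e₂]
  rw [Finset.sum_congr rfl fun w _ => this w, Finset.sum_add_distrib]
  congr 1
  · rw [Fintype.sum_prod_type]
    simp only [Finset.sum_ite_eq, Finset.mem_univ, if_true]
    exact sum_pathGraph_adj (fun t => u t (y.val + 1)) (h₁ _ y.2) (h₂ _ y.2) x
  · rw [Fintype.sum_prod_type_right]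
    simp only [Finset.sum_ite_eq, Finset.mem_univ, if_true]
    exact sum_pathGraph_adj (fun t => u (x.val + 1) t) (h₃ _ x.2) (h₄ _ x.2) y

/-- A solution of the discrete wave equation over `ℤ/2ℤ` that vanishes on the boundary of a
rectangle is the sum of two waves. -/
theorem exists_waves {m n ε : ℕ} (hm : 0 < m) (hn : 0 < n) (u : ℕ → ℕ → ZMod 2)
    (h₁ : ∀ y ≤ n, u 0 y = 0) (h₂ : ∀ y ≤ n, u m y = 0) (h₃ : ∀ x ≤ m, u x 0 = 0)
    (h₄ : ∀ x ≤ m, u x n = 0)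
    (hp : ∀ x y, (x + y) % 2 ≠ ε → u x y = 0)
    (hw : ∀ x y, x + 1 < m → y + 1 < n →
      (u (x + 2) (y + 1) + u x (y + 1)) + (u (x + 1) (y + 2) + u (x + 1) y) = 0) :
    ∃ F : ℕ → ZMod 2, F 0 = 0 ∧ F 1 = 0 ∧ (∀ t, t % 2 ≠ ε → F t = 0) ∧
      (∀ t < m + n, F t = F (fold (Nat.gcd m n) t)) ∧
      ∀ x ≤ m, ∀ y ≤ n, u x y = F (x + y) + F ((x : ℤ) - y).natAbs := by
  -- `P t` is `(F t, F (t + 1))`. The recursion is forced by the column `x = 1`, which must be `F (y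
  -- + 1) + F |y - 1|`; `fold n` extends this column to an even `2 * n`-periodic function.
  let P : ℕ → ZMod 2 × ZMod 2 := fun t =>
    Nat.rec (0, 0) (fun t p => (p.2, p.1 + u 1 (fold n ((t + 1 : ℕ) : ℤ)))) t
  let F : ℕ → ZMod 2 := fun t => (P t).1
  have F0 : F 0 = 0 := rfl
  have F1 : F 1 = 0 := rfl
  have Fs : ∀ t, F (t + 2) = F t + u 1 (fold n ((t + 1 : ℕ) : ℤ)) := fun t => rfl
  have two : ∀ a : ZMod 2, a + a = 0 := by decide
  have FZ : ∀ t : ℤ, F (t + 1).natAbs + F (t - 1).natAbs = u 1 (fold n t) := by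
    intro t
    obtain ⟨k, rfl | rfl⟩ := t.eq_nat_or_neg
    · rcases k with _ | k
      · have : fold n ((0 : ℕ) : ℤ) = 0 := fold_of_le (Nat.zero_le n)
        rw [this]
        exact (two _).trans (h₃ 1 hm).symm
      · rw [show (((k + 1 : ℕ) : ℤ) + 1).natAbs = k + 2 by omega,
          show (((k + 1 : ℕ) : ℤ) - 1).natAbs = k by omega, Fs, add_right_comm, two, zero_add]
    · rcases k with _ | k
      · have : fold n (-((0 : ℕ) : ℤ)) = 0 := by
          rw [fold_neg]
          exact fold_of_le (Nat.zero_le n)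
        rw [this]
        exact (two _).trans (h₃ 1 hm).symm
      · rw [show (-((k + 1 : ℕ) : ℤ) + 1).natAbs = k by omega, fold_neg,
          show (-((k + 1 : ℕ) : ℤ) - 1).natAbs = k + 2 by omega, Fs, ← add_assoc, two, zero_add]
  have eq_of_add : ∀ a b : ZMod 2, a + b = 0 → a = b := by decide
  -- The symmetry of `F` about `n` comes from `u 1 n = 0` and from that of the extended column. Two
  -- consecutive values are carried because the recursion has order two.
  have refl_n : ∀ x : ℕ, F ((n : ℤ) + x).natAbs = F ((n : ℤ) - x).natAbs ∧
      F ((n : ℤ) + (x + 1)).natAbs = F ((n : ℤ) - (x + 1)).natAbs := by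
    intro x
    induction x with
    | zero =>
      refine ⟨by simp, eq_of_add _ _ ?_⟩
      have := FZ n
      rw [fold_of_le le_rfl, h₄ 1 hm] at this
      simpa using this
    | succ x ih =>
      refine ⟨by exact_mod_cast ih.2, eq_of_add _ _ ?_⟩
      have e₁ := FZ (n + (x + 1))
      have e₂ := FZ (n - (x + 1))
      have e₃ : fold n ((n : ℤ) + (x + 1)) = fold n ((n : ℤ) - (x + 1)) :=
        fold_eq_of_dvd_add ⟨1, by ring⟩
      rw [e₃, ← e₂, show (n : ℤ) + (x + 1) - 1 = n + x by ring,
        show (n : ℤ) - (x + 1) + 1 = n - x by ring, ← ih.1] at e₁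
      have e₄ : F ((n : ℤ) + (x + 1) + 1).natAbs = F ((n : ℤ) - (x + 1) - 1).natAbs := by
        have := two (F ((n : ℤ) + x).natAbs)
        generalize F ((n : ℤ) + (x + 1) + 1).natAbs = p at *
        generalize F ((n : ℤ) - (x + 1) - 1).natAbs = q at *
        generalize F ((n : ℤ) + x).natAbs = r at *
        clear * - e₁
        revert p q r
        decide
      push_cast
      rw [show (n : ℤ) + (x + 1 + 1) = n + (x + 1) + 1 by ring,
        show (n : ℤ) - (x + 1 + 1) = n - (x + 1) - 1 by ring, e₄]
      exact two _
  have wave : ∀ x ≤ m, ∀ y ≤ n, u x y = F (x + y) + F ((x : ℤ) - y).natAbs := by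
    intro x
    induction x using Nat.twoStepInduction with
    | zero =>
      intro _ y hy
      rw [h₁ y hy, show (((0 : ℕ) : ℤ) - y).natAbs = 0 + y by omega, two]
    | one =>
      intro _ y hy
      have := FZ y
      rw [fold_of_le hy] at this
      rw [← this, show ((y : ℤ) + 1).natAbs = 1 + y by omega,
        show ((y : ℤ) - 1).natAbs = (((1 : ℕ) : ℤ) - y).natAbs by omega]
    | more x ih₀ ih₁ =>
      intro hx y hy
      rcases Nat.eq_zero_or_pos y with rfl | hy0
      · rw [h₃ _ hx, show ((((x + 2 : ℕ) : ℤ)) - (0 : ℕ)).natAbs = x + 2 + 0 by omega, two]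
      -- On the wall `y = n` the wave equation is not available; the symmetry of `F` about `n`
      -- supplies the zero boundary value.
      rcases hy.eq_or_lt with rfl | hlt
      · have := (refl_n (x + 2)).1
        rw [h₄ _ hx, show x + 2 + y = ((y : ℤ) + (x + 2 : ℕ)).natAbs by omega, this,
          show ((y : ℤ) - (x + 2 : ℕ)).natAbs = (((x + 2 : ℕ) : ℤ) - y).natAbs by omega, two]
      · obtain ⟨z, rfl⟩ : ∃ z, y = z + 1 := ⟨y - 1, by omega⟩
        have e := hw x z (by omega) hlt
        rw [ih₀ (by omega) (z + 1) hy, ih₁ (by omega) (z + 2) (by omega),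
          ih₁ (by omega) z (by omega)] at e
        rw [show x + 1 + (z + 2) = x + 2 + (z + 1) by omega,
          show x + 1 + z = x + (z + 1) by omega,
          show (((x + 1 : ℕ) : ℤ) - (z + 2 : ℕ)).natAbs = ((x : ℤ) - (z + 1 : ℕ)).natAbs by omega,
          show (((x + 1 : ℕ) : ℤ) - z).natAbs = (((x + 2 : ℕ) : ℤ) - (z + 1 : ℕ)).natAbs by omega]
          at e
        generalize u (x + 2) (z + 1) = p at *
        generalize F (x + 2 + (z + 1)) = q at *
        generalize F (x + (z + 1)) = r at *
        generalize F ((x : ℤ) - (z + 1 : ℕ)).natAbs = s at *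
        generalize F (((x + 2 : ℕ) : ℤ) - (z + 1 : ℕ)).natAbs = t at *
        clear * - e
        revert p q r s t
        decide
  refine ⟨F, F0, F1, ?_, ?_, wave⟩
  · intro t
    induction t using Nat.twoStepInduction with
    | zero => exact fun _ => F0
    | one => exact fun _ => F1
    | more t ih _ =>
      intro ht
      rw [Fs, ih (by omega), hp, add_zero]
      have := fold_emod_two n ((t + 1 : ℕ) : ℤ)
      omega
  · apply eq_fold_gcd_of_reflections F m n hm hn
    · intro y hy
      have := wave m le_rfl y hy.le
      rw [h₂ y hy.le] at this
      exact eq_of_add _ _ this.symm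
    · intro x hx
      rw [← (refl_n x).1]
      congr 1

/-- The function on `ℕ` that takes the values `h i` at `2 * i + 2 + ε` and vanishes elsewhere. -/
def spread {d : ℕ} (ε : ℕ) (h : Fin d → ZMod 2) (r : ℕ) : ZMod 2 :=
  if hr : (r % 2 = ε ∧ 2 ≤ r) ∧ (r - 2) / 2 < d then h ⟨(r - 2) / 2, hr.2⟩ else 0

/-- The coordinates are the values of `F` at the arguments of parity `ε` in `2, …, g`. There are `d`
of them, where `g = 2 * d + 1`, because `F 0 = F 1 = 0` is the normalisation. -/
theorem card_blackKernel {m n : ℕ} (hm : 1 ≤ m) (hn : 1 ≤ n) (hg : Odd (Nat.gcd m n))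
    (c : (rectGrid (m - 1) (n - 1)).Coloring Bool) :
    Nat.card (blackKernel (rectGrid (m - 1) (n - 1)) c) = 2 ^ ((Nat.gcd m n - 1) / 2) := by
  classical
  obtain ⟨ε, hε, hc⟩ := exists_parity_of_coloring c
  obtain ⟨d, hd⟩ := hg
  rw [show (Nat.gcd m n - 1) / 2 = d by omega]
  have hgm : Nat.gcd m n ≤ m := Nat.gcd_le_left n hm
  have hgn : Nat.gcd m n ≤ n := Nat.gcd_le_right m hn
  have d₁ : ((Nat.gcd m n : ℕ) : ℤ) ∣ m := by exact_mod_cast Nat.gcd_dvd_left m n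
  have d₂ : ((Nat.gcd m n : ℕ) : ℤ) ∣ n := by exact_mod_cast Nat.gcd_dvd_right m n
  have two : ∀ a : ZMod 2, a + a = 0 := by decide
  have eq_of_add : ∀ a b : ZMod 2, a + b = 0 → a = b := by decide
  set g := Nat.gcd m n with hgdef
  let U : (Fin d → ZMod 2) → ℕ → ℕ → ZMod 2 := fun h x y =>
    spread ε h (fold g ((x : ℤ) + y)) + spread ε h (fold g ((x : ℤ) - y))
  have hU : ∀ h, (fun v : Fin (m - 1) × Fin (n - 1) => U h (v.1.val + 1) (v.2.val + 1)) ∈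
      blackKernel (rectGrid (m - 1) (n - 1)) c := by
    intro h
    refine mem_blackKernel.2 ⟨fun v => ?_, fun v hv => ?_⟩
    · rw [sum_rectGrid_adj (U h)]
      · simp only [U]
        push_cast
        rw [show (v.1.val : ℤ) + 2 + (v.2.val + 1) = v.1.val + 1 + (v.2.val + 2) by ring,
          show (v.1.val : ℤ) + 2 - (v.2.val + 1) = v.1.val + 1 - v.2.val by ring,
          show (v.1.val : ℤ) + (v.2.val + 1) = v.1.val + 1 + v.2.val by ring,
          show (v.1.val : ℤ) - (v.2.val + 1) = v.1.val + 1 - (v.2.val + 2) by ring]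
        generalize spread ε h _ = p
        generalize spread ε h _ = q
        generalize spread ε h _ = r
        generalize spread ε h _ = s
        revert p q r s
        decide
      · intro y _
        simp only [U]
        rw [fold_eq_of_dvd_add (t := ((0 : ℕ) : ℤ) - y) ⟨0, by push_cast; ring⟩, two]
      · intro y _
        simp only [U]
        rw [fold_eq_of_dvd_add (t := ((m - 1 + 1 : ℕ) : ℤ) - y), two]
        rw [Nat.sub_add_cancel hm, show (m : ℤ) + y + (m - y) = 2 * m by ring]
        exact mul_dvd_mul_left 2 d₁
      · intro x _
        simp only [U]
        rw [fold_eq_of_dvd_sub (t := (x : ℤ) - (0 : ℕ)) ⟨0, by push_cast; ring⟩, two]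
      · intro x _
        simp only [U]
        rw [fold_eq_of_dvd_sub (t := (x : ℤ) - (n - 1 + 1 : ℕ)), two]
        rw [Nat.sub_add_cancel hn, show (x : ℤ) + n - (x - n) = 2 * n by ring]
        exact mul_dvd_mul_left 2 d₂
    · rw [Ne, hc v] at hv
      have e₁ := fold_emod_two g (((v.1.val + 1 : ℕ) : ℤ) + (v.2.val + 1 : ℕ))
      have e₂ := fold_emod_two g (((v.1.val + 1 : ℕ) : ℤ) - (v.2.val + 1 : ℕ))
      simp only [U]
      rw [spread, spread, dif_neg (by omega), dif_neg (by omega), add_zero]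
  let E : (Fin d → ZMod 2) → blackKernel (rectGrid (m - 1) (n - 1)) c := fun h => ⟨_, hU h⟩
  have hE : Function.Bijective E := by
    constructor
    · intro h h' e
      have hval : ∀ x y, 0 < x → x < m → 0 < y → y < n → U h x y = U h' x y := by
        intro x y hx hxm hy hyn
        have := congrFun (congrArg Subtype.val e) (⟨x - 1, by omega⟩, ⟨y - 1, by omega⟩)
        simp only [E] at this
        rwa [Nat.sub_add_cancel hx, Nat.sub_add_cancel hy] at this
      -- The cell `(r + 1, 1)` carries `F (r + 2) + F r`, so the kernel vector determines `F` two
      -- steps at a time.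
      have key : ∀ r ≤ g, spread ε h r = spread ε h' r := by
        intro r
        induction r using Nat.twoStepInduction with
        | zero => intro _; simp [spread]
        | one => intro _; simp [spread]
        | more r ih _ =>
          intro hr
          have := hval (r + 1) 1 (by omega) (by omega) (by omega) (by omega)
          simp only [U] at this
          rw [show ((r + 1 : ℕ) : ℤ) + (1 : ℕ) = (r + 2 : ℕ) by push_cast; ring,
            show ((r + 1 : ℕ) : ℤ) - (1 : ℕ) = r by push_cast; ring, fold_of_le hr,
            fold_of_le (show r ≤ g by omega), ih (by omega)] at this
          exact add_right_cancel this
      ext i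
      have := key (2 * i + 2 + ε) (by omega)
      rw [spread, spread, dif_pos (by omega), dif_pos (by omega)] at this
      have hi : (⟨(2 * i + 2 + ε - 2) / 2, by omega⟩ : Fin d) = i := Fin.ext (by simp only; omega)
      rwa [hi] at this
    · rintro ⟨f, hf⟩
      obtain ⟨hf₁, hf₂⟩ := mem_blackKernel.1 hf
      let u : ℕ → ℕ → ZMod 2 := fun x y =>
        if h : (0 < x ∧ x < m) ∧ (0 < y ∧ y < n) then f (⟨x - 1, by omega⟩, ⟨y - 1, by omega⟩) else 0
      have hu : ∀ v : Fin (m - 1) × Fin (n - 1), u (v.1.val + 1) (v.2.val + 1) = f v := by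
        rintro ⟨x, y⟩
        simp only [u]
        rw [dif_pos (by omega)]
        rfl
      have u₁ : ∀ y, u 0 y = 0 := fun y => dif_neg (by omega)
      have u₂ : ∀ y, u m y = 0 := fun y => dif_neg (by omega)
      have u₃ : ∀ x, u x 0 = 0 := fun x => dif_neg (by omega)
      have u₄ : ∀ x, u x n = 0 := fun x => dif_neg (by omega)
      obtain ⟨F, F0, F1, Fp, Fg, Fw⟩ := exists_waves (ε := ε) hm hn u (fun y _ => u₁ y)
        (fun y _ => u₂ y) (fun x _ => u₃ x) (fun x _ => u₄ x)
        (by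
          intro x y hxy
          simp only [u]
          split_ifs with h
          · apply hf₂
            rw [Ne, hc]
            simp only
            omega
          · rfl)
        (by
          intro x y hx hy
          have := hf₁ (⟨x, by omega⟩, ⟨y, by omega⟩)
          simp only [← hu] at this
          rw [sum_rectGrid_adj u (fun y _ => u₁ y)
            (fun y _ => by rw [Nat.sub_add_cancel hm]; exact u₂ y) (fun x _ => u₃ x)
            (fun x _ => by rw [Nat.sub_add_cancel hn]; exact u₄ x)] at this
          exact this)
      refine ⟨fun i => F (2 * i + 2 + ε), Subtype.ext (funext fun v => ?_)⟩
      have hs : ∀ r ≤ g, spread ε (fun i : Fin d => F (2 * i + 2 + ε)) r = F r := by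
        intro r hr
        rw [spread]
        split_ifs with h
        · simp only
          congr 1
          omega
        · by_cases hp : r % 2 = ε
          · rcases (show r = 0 ∨ r = 1 by omega) with rfl | rfl
            · exact F0.symm
            · exact F1.symm
          · exact (Fp r hp).symm
      have hg0 : 0 < g := by omega
      simp only [E, U]
      obtain ⟨⟨x, hx⟩, ⟨y, hy⟩⟩ := v
      rw [hs _ (fold_le hg0 _), hs _ (fold_le hg0 _), ← hu, Fw _ (by simp only; omega) _
        (by simp only; omega), Fg (_ + _) (by simp only; omega), Fg (Int.natAbs _) (by omega),
        fold_natAbs]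
      push_cast
      rfl
  rw [← Nat.card_congr (Equiv.ofBijective E hE), Nat.card_fun]
  simp

/-! ### Domino tilings and flips -/

/-- Two cells of the square lattice are neighbours. -/
def CellAdj (u v : ℕ × ℕ) : Prop :=
  u.1 = v.1 ∧ (u.2 + 1 = v.2 ∨ v.2 + 1 = u.2) ∨ u.2 = v.2 ∧ (u.1 + 1 = v.1 ∨ v.1 + 1 = u.1)

/-- `μ` restricts to an involution of the `a × b` rectangle that sends every cell to a neighbour,
that is, to a domino tiling. -/
def IsTiling (a b : ℕ) (μ : ℕ × ℕ → ℕ × ℕ) : Prop :=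
  ∀ x y, x < a → y < b →
    (μ (x, y)).1 < a ∧ (μ (x, y)).2 < b ∧ μ (μ (x, y)) = (x, y) ∧ CellAdj (x, y) (μ (x, y))

/-- The two dominoes of a `2 × 2` square with lowest corner `(x, y)` are rotated. -/
def flipSquare (x y : ℕ) (μ : ℕ × ℕ → ℕ × ℕ) (v : ℕ × ℕ) : ℕ × ℕ :=
  Equiv.swap (x, y) (x + 1, y + 1) (μ (Equiv.swap (x, y) (x + 1, y + 1) v))

/-- The `2 × 2` square with lowest corner `(x, y)` consists of two dominoes. -/
def Flippable (x y : ℕ) (μ : ℕ × ℕ → ℕ × ℕ) : Prop :=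
  μ (x, y) = (x, y + 1) ∧ μ (x + 1, y) = (x + 1, y + 1) ∨
    μ (x, y) = (x + 1, y) ∧ μ (x, y + 1) = (x + 1, y + 1)

section Flip

variable {a b x y : ℕ} {μ : ℕ × ℕ → ℕ × ℕ}

theorem IsTiling.eq_of_eq (h : IsTiling a b μ) {u v : ℕ × ℕ} (hx : u.1 < a) (hy : u.2 < b)
    (e : μ u = v) : μ v = u := by
  rw [← e]
  exact (h u.1 u.2 hx hy).2.2.1

theorem flipSquare_apply_left (x y : ℕ) (μ : ℕ × ℕ → ℕ × ℕ) :
    flipSquare x y μ (x, y) = Equiv.swap (x, y) (x + 1, y + 1) (μ (x + 1, y + 1)) := by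
  rw [flipSquare, Equiv.swap_apply_left]

theorem flipSquare_apply_right (x y : ℕ) (μ : ℕ × ℕ → ℕ × ℕ) :
    flipSquare x y μ (x + 1, y + 1) = Equiv.swap (x, y) (x + 1, y + 1) (μ (x, y)) := by
  rw [flipSquare, Equiv.swap_apply_right]

theorem swap_other {u v : ℕ} (x y : ℕ) (h₁ : ¬ (u = x ∧ v = y)) (h₂ : ¬ (u = x + 1 ∧ v = y + 1)) :
    Equiv.swap (x, y) (x + 1, y + 1) (u, v) = (u, v) :=
  Equiv.swap_apply_of_ne_of_ne (by simpa using h₁) (by simpa using h₂)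

theorem flipSquare_apply_other {u v : ℕ} (x y : ℕ) (μ : ℕ × ℕ → ℕ × ℕ) (h₁ : ¬ (u = x ∧ v = y))
    (h₂ : ¬ (u = x + 1 ∧ v = y + 1)) :
    flipSquare x y μ (u, v) = Equiv.swap (x, y) (x + 1, y + 1) (μ (u, v)) := by
  rw [flipSquare, swap_other x y h₁ h₂]

theorem flipSquare_horizontal (h : IsTiling a b μ) (hx : x + 1 < a) (hy : y + 1 < b)
    (h₁ : μ (x, y) = (x, y + 1)) (h₂ : μ (x + 1, y) = (x + 1, y + 1)) :
    flipSquare x y μ (x, y) = (x + 1, y) ∧ flipSquare x y μ (x + 1, y) = (x, y) ∧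
      flipSquare x y μ (x, y + 1) = (x + 1, y + 1) ∧ flipSquare x y μ (x + 1, y + 1) = (x, y + 1) := by
  have h₃ := h.eq_of_eq (u := (x, y)) (by simp only; omega) (by simp only; omega) h₁
  have h₄ := h.eq_of_eq (u := (x + 1, y)) (by simp only; omega) (by simp only; omega) h₂
  refine ⟨?_, ?_, ?_, ?_⟩
  · rw [flipSquare_apply_left, h₄, swap_other] <;> omega
  · rw [flipSquare_apply_other x y μ (by omega) (by omega), h₂, Equiv.swap_apply_right]
  · rw [flipSquare_apply_other x y μ (by omega) (by omega), h₃, Equiv.swap_apply_left]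
  · rw [flipSquare_apply_right, h₁, swap_other] <;> omega

theorem flipSquare_vertical (h : IsTiling a b μ) (hx : x + 1 < a) (hy : y + 1 < b)
    (h₁ : μ (x, y) = (x + 1, y)) (h₂ : μ (x, y + 1) = (x + 1, y + 1)) :
    flipSquare x y μ (x, y) = (x, y + 1) ∧ flipSquare x y μ (x, y + 1) = (x, y) ∧
      flipSquare x y μ (x + 1, y) = (x + 1, y + 1) ∧ flipSquare x y μ (x + 1, y + 1) = (x + 1, y) := by
  have h₃ := h.eq_of_eq (u := (x, y)) (by simp only; omega) (by simp only; omega) h₁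
  have h₄ := h.eq_of_eq (u := (x, y + 1)) (by simp only; omega) (by simp only; omega) h₂
  refine ⟨?_, ?_, ?_, ?_⟩
  · rw [flipSquare_apply_left, h₄, swap_other] <;> omega
  · rw [flipSquare_apply_other x y μ (by omega) (by omega), h₂, Equiv.swap_apply_right]
  · rw [flipSquare_apply_other x y μ (by omega) (by omega), h₃, Equiv.swap_apply_left]
  · rw [flipSquare_apply_right, h₁, swap_other] <;> omega

theorem Flippable.mapsTo (hf : Flippable x y μ) (h : IsTiling a b μ) (hx : x + 1 < a)
    (hy : y + 1 < b) {u v : ℕ} (huv : (u = x ∨ u = x + 1) ∧ (v = y ∨ v = y + 1)) :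
    ((μ (u, v)).1 = x ∨ (μ (u, v)).1 = x + 1) ∧ ((μ (u, v)).2 = y ∨ (μ (u, v)).2 = y + 1) := by
  rcases hf with ⟨h₁, h₂⟩ | ⟨h₁, h₂⟩
  · have h₃ := h.eq_of_eq (u := (x, y)) (by simp only; omega) (by simp only; omega) h₁
    have h₄ := h.eq_of_eq (u := (x + 1, y)) (by simp only; omega) (by simp only; omega) h₂
    obtain ⟨rfl | rfl, rfl | rfl⟩ := huv
    · simp [h₁]
    · simp [h₃]
    · simp [h₂]
    · simp [h₄]
  · have h₃ := h.eq_of_eq (u := (x, y)) (by simp only; omega) (by simp only; omega) h₁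
    have h₄ := h.eq_of_eq (u := (x, y + 1)) (by simp only; omega) (by simp only; omega) h₂
    obtain ⟨rfl | rfl, rfl | rfl⟩ := huv
    · simp [h₁]
    · simp [h₂]
    · simp [h₃]
    · simp [h₄]

theorem flipSquare_other (h : IsTiling a b μ) (hf : Flippable x y μ) (hx : x + 1 < a) (hy : y + 1 < b)
    {u v : ℕ} (hu : u < a) (hv : v < b)
    (huv : ¬ ((u = x ∨ u = x + 1) ∧ (v = y ∨ v = y + 1))) : flipSquare x y μ (u, v) = μ (u, v) := by
  have hne : ¬ (((μ (u, v)).1 = x ∨ (μ (u, v)).1 = x + 1) ∧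
      ((μ (u, v)).2 = y ∨ (μ (u, v)).2 = y + 1)) := by
    intro hm
    have := hf.mapsTo h hx hy hm
    rw [Prod.mk.eta, (h u v hu hv).2.2.1] at this
    exact huv this
  rw [flipSquare_apply_other x y μ (by omega) (by omega)]
  exact swap_other (u := (μ (u, v)).1) (v := (μ (u, v)).2) x y (by omega) (by omega)

theorem IsTiling.flipSquare_isTiling (h : IsTiling a b μ) (hf : Flippable x y μ) (hx : x + 1 < a)
    (hy : y + 1 < b) : IsTiling a b (flipSquare x y μ) := by
  intro u v hu hv
  by_cases huv : (u = x ∨ u = x + 1) ∧ (v = y ∨ v = y + 1)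
  · rcases hf with ⟨h₁, h₂⟩ | ⟨h₁, h₂⟩
    · obtain ⟨e₁, e₂, e₃, e₄⟩ := flipSquare_horizontal h hx hy h₁ h₂
      obtain ⟨rfl | rfl, rfl | rfl⟩ := huv
      · rw [e₁, e₂]; simp [CellAdj]; omega
      · rw [e₃, e₄]; simp [CellAdj]; omega
      · rw [e₂, e₁]; simp [CellAdj]; omega
      · rw [e₄, e₃]; simp [CellAdj]; omega
    · obtain ⟨e₁, e₂, e₃, e₄⟩ := flipSquare_vertical h hx hy h₁ h₂
      obtain ⟨rfl | rfl, rfl | rfl⟩ := huv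
      · rw [e₁, e₂]; simp [CellAdj]; omega
      · rw [e₂, e₁]; simp [CellAdj]; omega
      · rw [e₃, e₄]; simp [CellAdj]; omega
      · rw [e₄, e₃]; simp [CellAdj]; omega
  · rw [flipSquare_other h hf hx hy hu hv huv]
    obtain ⟨k₁, k₂, k₃, k₄⟩ := h u v hu hv
    refine ⟨k₁, k₂, ?_, k₄⟩
    have := flipSquare_other h hf hx hy (u := (μ (u, v)).1) (v := (μ (u, v)).2) k₁ k₂ (by
      intro hm
      have := hf.mapsTo h hx hy hm
      rw [Prod.mk.eta, k₃] at this
      exact huv this)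
    rw [Prod.mk.eta] at this
    rw [this, k₃]

end Flip

/-- A vertical domino whose right neighbour in the upper row is not part of a domino that sticks
out of the rows below can be turned by flips that leave all earlier cells alone. -/
theorem exists_horizontal {a b : ℕ} {Q : (ℕ × ℕ → ℕ × ℕ) → Prop}
    (hQ : ∀ μ x y, IsTiling a b μ → x + 1 < a → y + 1 < b → Flippable x y μ → Q (flipSquare x y μ) → Q μ)
    (d x y : ℕ) (μ : ℕ × ℕ → ℕ × ℕ) (hd : x + d = a) (h : IsTiling a b μ) (hx : x + 1 < a)
    (hy : y + 1 < b) (h₁ : μ (x, y) = (x + 1, y))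
    (h₂ : ∀ u, u + 1 = x → μ (x, y + 1) ≠ (u, y + 1)) :
    ∃ μ', IsTiling a b μ' ∧ (Q μ' → Q μ) ∧ μ' (x, y) = (x, y + 1) ∧
      ∀ u v, u < a → v < b → (u < x ∨ u = x ∧ v < y) → μ' (u, v) = μ (u, v) := by
  induction d generalizing x y μ with
  | zero => omega
  | succ d ih =>
    have h₁' := h.eq_of_eq (u := (x, y)) (by simp only; omega) (by simp only; omega) h₁
    have final : ∀ μ', IsTiling a b μ' → (Q μ' → Q μ) → μ' (x, y) = (x + 1, y) →
        μ' (x, y + 1) = (x + 1, y + 1) →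
        (∀ u v, u < a → v < b → (u < x ∨ u = x ∧ v < y) → μ' (u, v) = μ (u, v)) →
        ∃ μ', IsTiling a b μ' ∧ (Q μ' → Q μ) ∧ μ' (x, y) = (x, y + 1) ∧
          ∀ u v, u < a → v < b → (u < x ∨ u = x ∧ v < y) → μ' (u, v) = μ (u, v) := by
      intro μ' h' hQ' e₁ e₂ e₃
      have hf : Flippable x y μ' := Or.inr ⟨e₁, e₂⟩
      refine ⟨flipSquare x y μ', h'.flipSquare_isTiling hf hx hy, fun q => hQ' (hQ μ' x y h' hx hy hf q),
        (flipSquare_vertical h' hx hy e₁ e₂).1, fun u v hu hv huv => ?_⟩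
      rw [flipSquare_other h' hf hx hy hu hv (by omega), e₃ u v hu hv huv]
    obtain ⟨k₁, k₂, k₃, k₄⟩ := h x (y + 1) (by omega) hy
    obtain ⟨⟨p, q⟩, hpq⟩ : ∃ w, μ (x, y + 1) = w := ⟨_, rfl⟩
    rw [hpq] at k₁ k₂ k₃ k₄
    simp only [CellAdj] at k₁ k₂ k₄
    -- If `(x, y + 1)` also starts a vertical domino, one flip suffices. If it starts a horizontal
    -- one, that domino is first made vertical by a flip with the domino above it, itself made
    -- horizontal by recursion if necessary.
    have hcase : (p = x ∧ q = y + 2) ∨ (p = x ∧ q = y) ∨ (p = x + 1 ∧ q = y + 1) ∨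
        (p + 1 = x ∧ q = y + 1) := by omega
    rcases hcase with ⟨rfl, rfl⟩ | ⟨rfl, rfl⟩ | ⟨rfl, rfl⟩ | ⟨hp, rfl⟩
    · obtain ⟨l₁, l₂, l₃, l₄⟩ := h (p + 1) (y + 1) hx hy
      -- the square to the right is made of two horizontal dominoes, possibly after a recursion
      have right : ∀ μ', IsTiling a b μ' → (Q μ' → Q μ) → μ' (p + 1, y + 1) = (p + 1, y + 2) →
          (∀ u v, u < a → v < b → (u < p + 1 ∨ u = p + 1 ∧ v < y + 1) → μ' (u, v) = μ (u, v)) →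
          ∃ μ', IsTiling a b μ' ∧ (Q μ' → Q μ) ∧ μ' (p, y) = (p, y + 1) ∧
            ∀ u v, u < a → v < b → (u < p ∨ u = p ∧ v < y) → μ' (u, v) = μ (u, v) := by
        intro μ' h' hQ' e₁ e₂
        have e₃ : μ' (p, y + 1) = (p, y + 2) := by
          rw [e₂ _ _ (by omega) (by omega) (by omega), hpq]
        have hf : Flippable p (y + 1) μ' := Or.inl ⟨e₃, e₁⟩
        refine final (flipSquare p (y + 1) μ') (h'.flipSquare_isTiling hf hx k₂)
          (fun q => hQ' (hQ μ' p (y + 1) h' hx k₂ hf q)) ?_ ?_ ?_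
        · rw [flipSquare_other h' hf hx k₂ (by omega) (by omega) (by omega),
            e₂ _ _ (by omega) (by omega) (by omega), h₁]
        · exact (flipSquare_horizontal h' hx k₂ e₃ e₁).1
        · intro u v hu hv huv
          rw [flipSquare_other h' hf hx k₂ hu hv (by omega), e₂ u v hu hv (by omega)]
      obtain ⟨⟨r, s⟩, hrs⟩ : ∃ w, μ (p + 1, y + 1) = w := ⟨_, rfl⟩
      rw [hrs] at l₁ l₂ l₃ l₄
      simp only [CellAdj] at l₁ l₂ l₄
      have hcase : (r = p + 1 ∧ s = y + 2) ∨ (r = p + 1 ∧ s = y) ∨ (r = p + 2 ∧ s = y + 1) ∨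
        (r = p ∧ s = y + 1) := by omega
      rcases hcase with ⟨rfl, rfl⟩ | ⟨rfl, rfl⟩ | ⟨rfl, rfl⟩ | ⟨rfl, rfl⟩
      · exact right μ h id hrs fun _ _ _ _ _ => rfl
      · rw [h₁'] at l₃
        simp at l₃
      -- The recursion moves along the diagonal and ends because the last row starts no vertical
      -- domino. The side condition holds since `(p, y + 2)` is already the partner of `(p, y + 1)`.
      · obtain ⟨μ', h', hQ', e₁, e₂⟩ := ih (p + 1) (y + 1) μ (by omega) h (by omega) k₂ hrs (by
          intro u hu e
          obtain rfl : u = p := by omega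
          have := h.eq_of_eq (u := (u + 1, y + 1 + 1)) (by simp only; omega) (by simp only; omega) e
          rw [k₃] at this
          simp at this)
        exact right μ' h' hQ' e₁ e₂
      · rw [hpq] at l₃
        simp at l₃
    · rw [h₁] at k₃
      simp at k₃
    · exact final μ h id h₁ hpq fun _ _ _ _ _ => rfl
    · exact absurd hpq (h₂ p hp)

/-- The partner of a cell in the tiling by horizontal dominoes. -/
def horizontalPartner (v : ℕ × ℕ) : ℕ × ℕ := (v.1, if v.2 % 2 = 0 then v.2 + 1 else v.2 - 1)

/-- Every domino tiling of a rectangle of even width is connected by flips to the tiling by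
horizontal dominoes. -/
theorem IsTiling.flip_induction {a b : ℕ} (hb : b % 2 = 0) {Q : (ℕ × ℕ → ℕ × ℕ) → Prop}
    (hQ : ∀ μ x y, IsTiling a b μ → x + 1 < a → y + 1 < b → Flippable x y μ → Q (flipSquare x y μ) → Q μ)
    (h0 : ∀ μ, (∀ x y, x < a → y < b → μ (x, y) = horizontalPartner (x, y)) → Q μ)
    {μ : ℕ × ℕ → ℕ × ℕ} (h : IsTiling a b μ) : Q μ := by
  -- Cells are swept row by row, two columns at a time, everything already passed being in
  -- horizontal position. The next cell can then only be matched to the right or into the next row,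
  -- and `exists_horizontal` removes the second case.
  have rows : ∀ d x, x + d = a → ∀ μ, IsTiling a b μ →
      (∀ u v, u < a → v < b → u < x → μ (u, v) = horizontalPartner (u, v)) → Q μ := by
    intro d
    induction d with
    | zero =>
      intro x hx μ _ hμ
      exact h0 μ fun u v hu hv => hμ u v hu hv (by omega)
    | succ d ih =>
      intro x hx
      have cols : ∀ e y, 2 * y + 2 * e = b → ∀ μ, IsTiling a b μ →
          (∀ u v, u < a → v < b → (u < x ∨ u = x ∧ v < 2 * y) →
            μ (u, v) = horizontalPartner (u, v)) → Q μ := by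
        intro e
        induction e with
        | zero =>
          intro y hy μ h hμ
          exact ih (x + 1) (by omega) μ h fun u v hu hv hux => hμ u v hu hv (by omega)
        | succ e ihe =>
          intro y hy μ h hμ
          have good : ∀ μ', IsTiling a b μ' → μ' (x, 2 * y) = (x, 2 * y + 1) →
              (∀ u v, u < a → v < b → (u < x ∨ u = x ∧ v < 2 * y) →
                μ' (u, v) = horizontalPartner (u, v)) → Q μ' := by
            intro μ' h' e₁ e₂
            refine ihe (y + 1) (by omega) μ' h' fun u v hu hv huv => ?_
            by_cases hlt : u < x ∨ u = x ∧ v < 2 * y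
            · exact e₂ u v hu hv hlt
            · obtain ⟨rfl, rfl | rfl⟩ : u = x ∧ (v = 2 * y ∨ v = 2 * y + 1) := by omega
              · rw [e₁, horizontalPartner]
                simp
              · rw [h'.eq_of_eq (u := (u, 2 * y)) hu (by simp only; omega) e₁, horizontalPartner]
                simp only
                rw [if_neg (by omega)]
                rfl
          obtain ⟨k₁, k₂, k₃, k₄⟩ := h x (2 * y) (by omega) (by omega)
          obtain ⟨⟨p, q⟩, hpq⟩ : ∃ w, μ (x, 2 * y) = w := ⟨_, rfl⟩
          rw [hpq] at k₁ k₂ k₃ k₄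
          simp only [CellAdj] at k₁ k₂ k₄
          have hcase : (p = x ∧ q = 2 * y + 1) ∨ (p = x + 1 ∧ q = 2 * y) ∨
              (p < x ∨ p = x ∧ q < 2 * y) := by omega
          rcases hcase with ⟨rfl, rfl⟩ | ⟨rfl, rfl⟩ | hlt
          · exact good μ h hpq hμ
          · obtain ⟨μ', h', hQ', e₁, e₂⟩ := exists_horizontal hQ (d + 1) x (2 * y) μ (by omega) h
              k₁ (by omega) hpq (by
                intro u hu e
                have := h.eq_of_eq (u := (x, 2 * y + 1)) (by simp only; omega)
                  (by simp only; omega) e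
                rw [hμ u (2 * y + 1) (by omega) (by omega) (by omega), horizontalPartner] at this
                simp only [Prod.mk.injEq] at this
                omega)
            exact hQ' (good μ' h' e₁ fun u v hu hv huv => by
              rw [e₂ u v hu hv huv, hμ u v hu hv huv])
          · rw [hμ p q k₁ k₂ hlt, horizontalPartner] at k₃
            simp only [Prod.mk.injEq] at k₃
            split_ifs at k₃ <;> omega
      intro μ h hμ
      exact cols (b / 2) 0 (by omega) μ h fun u v hu hv huv => hμ u v hu hv (by omega)
  exact rows a 0 (by omega) μ h fun u v _ _ hu => absurd hu (Nat.not_lt_zero u)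

/-! ### Perfect matchings as permutations -/

/-- The spanning subgraph whose edges join `bl p` to `wh (σ p)`. -/
def subgraphOfPerm {V P : Type*} (G : SimpleGraph V) (bl wh : P → V) (σ : Equiv.Perm P)
    (hσ : ∀ p, G.Adj (bl p) (wh (σ p))) : G.Subgraph where
  verts := Set.univ
  Adj v w := ∃ p, (v = bl p ∧ w = wh (σ p)) ∨ (w = bl p ∧ v = wh (σ p))
  adj_sub := by
    rintro v w ⟨p, ⟨rfl, rfl⟩ | ⟨rfl, rfl⟩⟩
    · exact hσ p
    · exact (hσ p).symm
  edge_vert := fun _ => Set.mem_univ _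
  symm := ⟨fun _ _ ⟨p, h⟩ => ⟨p, h.symm⟩⟩

/-- The perfect matchings of a bipartite graph whose colour classes are both indexed by `P`
correspond to the permutations of `P` along the edges. -/
theorem numMatchings_eq_card_perm {V P : Type*} [Finite V] [Finite P] (G : SimpleGraph V)
    (bl wh : P → V) (hb : Function.Bijective (Sum.elim bl wh))
    (h₁ : ∀ p q, ¬ G.Adj (bl p) (bl q)) (h₂ : ∀ p q, ¬ G.Adj (wh p) (wh q)) :
    numMatchings G = Nat.card {σ : Equiv.Perm P // ∀ p, G.Adj (bl p) (wh (σ p))} := by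
  classical
  have bl_inj : Function.Injective bl := fun p q h =>
    Sum.inl_injective (hb.1 (show Sum.elim bl wh (Sum.inl p) = Sum.elim bl wh (Sum.inl q) from h))
  have wh_inj : Function.Injective wh := fun p q h =>
    Sum.inr_injective (hb.1 (show Sum.elim bl wh (Sum.inr p) = Sum.elim bl wh (Sum.inr q) from h))
  have bl_ne : ∀ p q, bl p ≠ wh q := fun p q h =>
    Sum.inl_ne_inr (hb.1 (show Sum.elim bl wh (Sum.inl p) = Sum.elim bl wh (Sum.inr q) from h))
  have cover : ∀ v, (∃ p, v = bl p) ∨ ∃ p, v = wh p := by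
    intro v
    obtain ⟨p | p, rfl⟩ := hb.2 v
    · exact Or.inl ⟨p, rfl⟩
    · exact Or.inr ⟨p, rfl⟩
  let S : {σ : Equiv.Perm P // ∀ p, G.Adj (bl p) (wh (σ p))} → G.Subgraph :=
    fun σ => subgraphOfPerm G bl wh σ.1 σ.2
  have hS : Function.Injective S := by
    rintro ⟨σ, hσ⟩ ⟨τ, hτ⟩ h
    apply Subtype.ext
    ext p
    have hadj : (S ⟨τ, hτ⟩).Adj (bl p) (wh (σ p)) := by
      rw [← h]
      exact ⟨p, Or.inl ⟨rfl, rfl⟩⟩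
    obtain ⟨q, ⟨e₁, e₂⟩ | ⟨e₁, -⟩⟩ := hadj
    · rw [bl_inj e₁]
      exact wh_inj (by rw [← e₂, bl_inj e₁])
    · exact absurd e₁.symm (bl_ne _ _)
  have hrange : {M : G.Subgraph | M.IsPerfectMatching} = Set.range S := by
    ext M
    constructor
    · rintro ⟨hM, hspan⟩
      have ex : ∀ p, ∃ q, M.Adj (bl p) (wh q) := by
        intro p
        obtain ⟨w, hw, -⟩ := hM (hspan (bl p))
        rcases cover w with ⟨q, rfl⟩ | ⟨q, rfl⟩
        · exact absurd hw.adj_sub (h₁ p q)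
        · exact ⟨q, hw⟩
      choose s hs using ex
      have s_inj : Function.Injective s := by
        intro p q h
        have e₁ := (hs p).symm
        rw [h] at e₁
        exact bl_inj ((hM (hspan (wh (s q)))).unique e₁ (hs q).symm)
      let σ : Equiv.Perm P := Equiv.ofBijective s (Finite.injective_iff_bijective.1 s_inj)
      refine ⟨⟨σ, fun p => (hs p).adj_sub⟩, SimpleGraph.Subgraph.ext ?_ ?_⟩
      · exact (Set.eq_univ_of_forall hspan).symm
      · ext v w
        constructor
        · rintro ⟨p, ⟨rfl, rfl⟩ | ⟨rfl, rfl⟩⟩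
          · exact hs p
          · exact (hs p).symm
        · intro hvw
          rcases cover v with ⟨p, rfl⟩ | ⟨q, rfl⟩
          · exact ⟨p, Or.inl ⟨rfl, (hM (hspan (bl p))).unique hvw (hs p)⟩⟩
          · rcases cover w with ⟨p, rfl⟩ | ⟨r, rfl⟩
            · exact ⟨p, Or.inr ⟨rfl, (hM (hspan (bl p))).unique hvw.symm (hs p)⟩⟩
            · exact absurd hvw.adj_sub (h₂ q r)
    · rintro ⟨⟨σ, hσ⟩, rfl⟩
      refine ⟨fun v _ => ?_, fun v => Set.mem_univ v⟩
      rcases cover v with ⟨p, rfl⟩ | ⟨q, rfl⟩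
      · refine ⟨wh (σ p), ⟨p, Or.inl ⟨rfl, rfl⟩⟩, ?_⟩
        rintro w ⟨q, ⟨e₁, rfl⟩ | ⟨-, e₁⟩⟩
        · rw [bl_inj e₁]
        · exact absurd e₁ (bl_ne _ _)
      · refine ⟨bl (σ.symm q), ⟨σ.symm q, Or.inr ⟨rfl, by rw [Equiv.apply_symm_apply]⟩⟩, ?_⟩
        rintro w ⟨p, ⟨e₁, -⟩ | ⟨rfl, e₁⟩⟩
        · exact absurd e₁.symm (bl_ne _ _)
        · rw [wh_inj e₁, Equiv.symm_apply_apply]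
  rw [numMatchings, hrange, ← Nat.card_coe_set_eq, Nat.card_range_of_injective hS]

/-! ### The Kasteleyn matrix and its signs -/

section Kasteleyn

variable {a h : ℕ}

/-- The black cell of the `p`-th horizontal domino. -/
def blackCell (p : Fin a × Fin h) : ℕ × ℕ := (p.1.val, 2 * p.2.val + p.1.val % 2)

/-- The white cell of the `p`-th horizontal domino. -/
def whiteCell (p : Fin a × Fin h) : ℕ × ℕ := (p.1.val, 2 * p.2.val + (1 - p.1.val % 2))

theorem blackCell_parity (p : Fin a × Fin h) : ((blackCell p).1 + (blackCell p).2) % 2 = 0 := by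
  simp only [blackCell]; omega

theorem whiteCell_parity (p : Fin a × Fin h) : ((whiteCell p).1 + (whiteCell p).2) % 2 = 1 := by
  simp only [whiteCell]; omega

theorem blackCell_injective : Function.Injective (blackCell (a := a) (h := h)) := by
  rintro ⟨⟨i, hi⟩, ⟨j, hj⟩⟩ ⟨⟨i', hi'⟩, ⟨j', hj'⟩⟩ e
  simp only [blackCell, Prod.mk.injEq, Fin.mk.injEq] at e ⊢
  omega

theorem whiteCell_injective : Function.Injective (whiteCell (a := a) (h := h)) := by
  rintro ⟨⟨i, hi⟩, ⟨j, hj⟩⟩ ⟨⟨i', hi'⟩, ⟨j', hj'⟩⟩ e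
  simp only [whiteCell, Prod.mk.injEq, Fin.mk.injEq] at e ⊢
  omega

theorem blackCell_ne_whiteCell (p q : Fin a × Fin h) : blackCell p ≠ whiteCell q := by
  intro e
  have h₁ := blackCell_parity p
  have h₂ := whiteCell_parity q
  rw [e] at h₁
  omega

theorem blackCell_lt (p : Fin a × Fin h) : (blackCell p).1 < a ∧ (blackCell p).2 < 2 * h := by
  simp only [blackCell]; omega

theorem whiteCell_lt (p : Fin a × Fin h) : (whiteCell p).1 < a ∧ (whiteCell p).2 < 2 * h := by
  simp only [whiteCell]; omega

theorem exists_blackCell {v : ℕ × ℕ} (h₁ : v.1 < a) (h₂ : v.2 < 2 * h) (hp : (v.1 + v.2) % 2 = 0) :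
    ∃ p : Fin a × Fin h, blackCell p = v :=
  ⟨(⟨v.1, h₁⟩, ⟨v.2 / 2, by omega⟩), Prod.ext rfl (by simp only [blackCell]; omega)⟩

theorem exists_whiteCell {v : ℕ × ℕ} (h₁ : v.1 < a) (h₂ : v.2 < 2 * h) (hp : (v.1 + v.2) % 2 = 1) :
    ∃ p : Fin a × Fin h, whiteCell p = v :=
  ⟨(⟨v.1, h₁⟩, ⟨v.2 / 2, by omega⟩), Prod.ext rfl (by simp only [whiteCell]; omega)⟩

theorem horizontalPartner_blackCell (p : Fin a × Fin h) :
    horizontalPartner (blackCell p) = whiteCell p := by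
  have e : (blackCell p).2 = 2 * p.2.val + p.1.val % 2 := rfl
  refine Prod.ext rfl ?_
  rw [horizontalPartner, e]
  simp only [whiteCell]
  split_ifs <;> omega

theorem exists_tiling_of_perm (σ : Equiv.Perm (Fin a × Fin h))
    (hσ : ∀ p, CellAdj (blackCell p) (whiteCell (σ p))) :
    ∃ μ, IsTiling a (2 * h) μ ∧ ∀ p, μ (blackCell p) = whiteCell (σ p) := by
  classical
  let μ : ℕ × ℕ → ℕ × ℕ := fun v =>
    if hb : ∃ p : Fin a × Fin h, blackCell p = v then whiteCell (σ hb.choose)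
    else if hw : ∃ p : Fin a × Fin h, whiteCell p = v then blackCell (σ.symm hw.choose) else v
  have hμb : ∀ p, μ (blackCell p) = whiteCell (σ p) := by
    intro p
    have hb : ∃ q : Fin a × Fin h, blackCell q = blackCell p := ⟨p, rfl⟩
    simp only [μ, dif_pos hb]
    rw [blackCell_injective hb.choose_spec]
  have hμw : ∀ p, μ (whiteCell p) = blackCell (σ.symm p) := by
    intro p
    have hb : ¬ ∃ q : Fin a × Fin h, blackCell q = whiteCell p :=
      fun ⟨q, hq⟩ => blackCell_ne_whiteCell q p hq
    have hw : ∃ q : Fin a × Fin h, whiteCell q = whiteCell p := ⟨p, rfl⟩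
    simp only [μ, dif_neg hb, dif_pos hw]
    rw [whiteCell_injective hw.choose_spec]
  have adj_symm : ∀ u v, CellAdj u v → CellAdj v u := by
    intro u v huv
    simp only [CellAdj] at huv ⊢
    omega
  refine ⟨μ, fun x y hx hy => ?_, hμb⟩
  rcases Nat.mod_two_eq_zero_or_one (x + y) with hp | hp
  · obtain ⟨p, hp⟩ := exists_blackCell (v := (x, y)) hx hy hp
    rw [← hp, hμb, hμw, Equiv.symm_apply_apply]
    exact ⟨(whiteCell_lt _).1, (whiteCell_lt _).2, rfl, hσ p⟩
  · obtain ⟨p, hp⟩ := exists_whiteCell (v := (x, y)) hx hy hp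
    rw [← hp, hμw, hμb, Equiv.apply_symm_apply]
    refine ⟨(blackCell_lt _).1, (blackCell_lt _).2, rfl, adj_symm _ _ ?_⟩
    have := hσ (σ.symm p)
    rwa [Equiv.apply_symm_apply] at this

open Classical in
/-- The Kasteleyn weight of an edge of the square lattice. -/
noncomputable def edgeWeight (u v : ℕ × ℕ) : ℤ :=
  if u.1 = v.1 ∧ (u.2 + 1 = v.2 ∨ v.2 + 1 = u.2) then 1
  else if u.2 = v.2 ∧ (u.1 + 1 = v.1 ∨ v.1 + 1 = u.1) then (-1) ^ u.2 else 0

theorem edgeWeight_of_row {u v : ℕ × ℕ} (e : u.1 = v.1 ∧ (u.2 + 1 = v.2 ∨ v.2 + 1 = u.2)) :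
    edgeWeight u v = 1 := if_pos e

theorem edgeWeight_of_column {u v : ℕ × ℕ} (e : u.2 = v.2 ∧ (u.1 + 1 = v.1 ∨ v.1 + 1 = u.1)) :
    edgeWeight u v = (-1) ^ u.2 := by
  rw [edgeWeight, if_neg (by omega), if_pos e]

theorem edgeWeight_of_not_adj {u v : ℕ × ℕ} (e : ¬ CellAdj u v) : edgeWeight u v = 0 := by
  simp only [CellAdj] at e
  rw [edgeWeight, if_neg (by omega), if_neg (by omega)]

/-- The two vertical edges of a unit square lie in adjacent columns and have opposite weights. This
is the sign that compensates for the transposition caused by a flip. -/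
theorem edgeWeight_square (x y : ℕ) {u v : ℕ × ℕ}
    (e : u = (x, y + 1) ∧ v = (x + 1, y) ∨ u = (x + 1, y) ∧ v = (x, y + 1)) :
    edgeWeight (x, y) v * edgeWeight (x + 1, y + 1) u =
        -(edgeWeight (x, y) u * edgeWeight (x + 1, y + 1) v) ∧
      edgeWeight u (x + 1, y + 1) * edgeWeight v (x, y) =
        -(edgeWeight u (x, y) * edgeWeight v (x + 1, y + 1)) := by
  have w₁ : edgeWeight (x, y) (x, y + 1) = 1 := edgeWeight_of_row (by simp)
  have w₂ : edgeWeight (x, y + 1) (x, y) = 1 := edgeWeight_of_row (by simp)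
  have w₃ : edgeWeight (x + 1, y) (x + 1, y + 1) = 1 := edgeWeight_of_row (by simp)
  have w₄ : edgeWeight (x + 1, y + 1) (x + 1, y) = 1 := edgeWeight_of_row (by simp)
  have w₅ : edgeWeight (x, y) (x + 1, y) = (-1) ^ y := edgeWeight_of_column (by simp)
  have w₆ : edgeWeight (x + 1, y) (x, y) = (-1) ^ y := edgeWeight_of_column (by simp)
  have w₇ : edgeWeight (x, y + 1) (x + 1, y + 1) = (-1) ^ (y + 1) := edgeWeight_of_column (by simp)
  have w₈ : edgeWeight (x + 1, y + 1) (x, y + 1) = (-1) ^ (y + 1) := edgeWeight_of_column (by simp)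
  have hs : (-1 : ℤ) ^ y * (-1) ^ y = 1 := by rw [← mul_pow]; simp
  rw [pow_succ] at w₇ w₈
  rcases e with ⟨rfl, rfl⟩ | ⟨rfl, rfl⟩
  · rw [w₁, w₂, w₃, w₄, w₅, w₆, w₇, w₈]
    constructor <;> linear_combination -hs
  · rw [w₁, w₂, w₃, w₄, w₅, w₆, w₇, w₈]
    constructor <;> linear_combination -hs

/-- The Kasteleyn matrix of the `a × 2h` rectangle. -/
noncomputable def kasteleyn (a h : ℕ) : Matrix (Fin a × Fin h) (Fin a × Fin h) ℤ :=
  Matrix.of fun p q => edgeWeight (blackCell p) (whiteCell q)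

theorem sign_mul_prod_mul_swap {P : Type*} [Fintype P] [DecidableEq P] (K : Matrix P P ℤ)
    (σ : Equiv.Perm P) {r t : P} (hrt : r ≠ t)
    (hK : K r (σ t) * K t (σ r) = -(K r (σ r) * K t (σ t))) :
    (Equiv.Perm.sign (σ * Equiv.swap r t) : ℤ) * ∏ p, K p ((σ * Equiv.swap r t) p) =
      (Equiv.Perm.sign σ : ℤ) * ∏ p, K p (σ p) := by
  have ht : t ∈ Finset.univ.erase r := Finset.mem_erase.2 ⟨hrt.symm, Finset.mem_univ _⟩
  rw [Equiv.Perm.sign_mul, Equiv.Perm.sign_swap hrt, ← Finset.mul_prod_erase _ _ (Finset.mem_univ r),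
    ← Finset.mul_prod_erase _ _ ht, ← Finset.mul_prod_erase _ (fun p => K p (σ p))
    (Finset.mem_univ r), ← Finset.mul_prod_erase _ (fun p => K p (σ p)) ht]
  have : ∏ p ∈ (Finset.univ.erase r).erase t, K p ((σ * Equiv.swap r t) p) =
      ∏ p ∈ (Finset.univ.erase r).erase t, K p (σ p) := by
    refine Finset.prod_congr rfl fun p hp => ?_
    rw [Finset.mem_erase, Finset.mem_erase] at hp
    rw [Equiv.Perm.mul_apply, Equiv.swap_apply_of_ne_of_ne hp.2.1 hp.1]
  rw [this, Equiv.Perm.mul_apply, Equiv.Perm.mul_apply, Equiv.swap_apply_left,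
    Equiv.swap_apply_right, ← mul_assoc (K r _), hK, ← mul_assoc (K r _)]
  push_cast
  ring

/-- All perfect matchings contribute `1` to the determinant of the Kasteleyn matrix. -/
theorem kasteleyn_sign (σ : Equiv.Perm (Fin a × Fin h))
    (hσ : ∀ p, CellAdj (blackCell p) (whiteCell (σ p))) :
    (Equiv.Perm.sign σ : ℤ) * ∏ p, kasteleyn a h p (σ p) = 1 := by
  obtain ⟨μ, hμ, hμσ⟩ := exists_tiling_of_perm σ hσ
  clear hσ
  revert σ
  -- The induction property quantifies over `σ`, because a flip changes the permutation together
  -- with the tiling.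
  refine hμ.flip_induction (by omega) (Q := fun μ => ∀ σ : Equiv.Perm (Fin a × Fin h),
    (∀ p, μ (blackCell p) = whiteCell (σ p)) →
      (Equiv.Perm.sign σ : ℤ) * ∏ p, kasteleyn a h p (σ p) = 1) ?_ ?_
  · intro μ x y hμ hx hy hf hQ σ hσ
    have hsq : μ (x, y) = (x, y + 1) ∧ μ (x + 1, y + 1) = (x + 1, y) ∨
        μ (x, y) = (x + 1, y) ∧ μ (x + 1, y + 1) = (x, y + 1) := by
      rcases hf with ⟨h₁, h₂⟩ | ⟨h₁, h₂⟩
      · exact Or.inl ⟨h₁, hμ.eq_of_eq (by simp only; omega) (by simp only; omega) h₂⟩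
      · exact Or.inr ⟨h₁, hμ.eq_of_eq (by simp only; omega) (by simp only; omega) h₂⟩
    obtain ⟨w₁, w₂⟩ := edgeWeight_square x y hsq
    rcases Nat.mod_two_eq_zero_or_one (x + y) with hp | hp
    · obtain ⟨p, hpA⟩ := exists_blackCell (a := a) (h := h) (v := (x, y)) (by simp only; omega)
        (by simp only; omega) hp
      obtain ⟨q, hqC⟩ := exists_blackCell (a := a) (h := h) (v := (x + 1, y + 1)) hx hy
        (by simp only; omega)
      have hpq : p ≠ q := by
        rintro rfl
        rw [hpA] at hqC
        simp at hqC
      -- `flipSquare` conjugates by the exchange of two opposite corners. If these are black, only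
      -- the sources are exchanged, and `σ` is multiplied by the transposition of `p` and `q`.
      rw [← sign_mul_prod_mul_swap (kasteleyn a h) σ hpq]
      · refine hQ _ fun r => ?_
        rw [flipSquare, ← hpA, ← hqC, blackCell_injective.swap_apply, hσ,
          Equiv.swap_apply_of_ne_of_ne (blackCell_ne_whiteCell _ _).symm
            (blackCell_ne_whiteCell _ _).symm]
        rfl
      · simp only [kasteleyn, Matrix.of_apply]
        rw [← hσ, ← hσ, hpA, hqC]
        exact w₁
    · obtain ⟨p, hpA⟩ := exists_whiteCell (a := a) (h := h) (v := (x, y)) (by simp only; omega)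
        (by simp only; omega) hp
      obtain ⟨q, hqC⟩ := exists_whiteCell (a := a) (h := h) (v := (x + 1, y + 1)) hx hy
        (by simp only; omega)
      have hpq : σ.symm p ≠ σ.symm q := by
        intro e
        rw [σ.symm.injective e, hqC] at hpA
        simp at hpA
      have hμw : ∀ r, μ (whiteCell r) = blackCell (σ.symm r) := by
        intro r
        have := hσ (σ.symm r)
        rw [Equiv.apply_symm_apply] at this
        exact hμ.eq_of_eq (blackCell_lt _).1 (blackCell_lt _).2 this
      -- If the corners are white, the targets are exchanged; moved across `σ`, this is the
      -- transposition of `σ.symm p` and `σ.symm q`.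
      rw [← sign_mul_prod_mul_swap (kasteleyn a h) σ hpq]
      · refine hQ _ fun r => ?_
        rw [flipSquare, ← hpA, ← hqC, Equiv.swap_apply_of_ne_of_ne (blackCell_ne_whiteCell _ _)
          (blackCell_ne_whiteCell _ _), hσ, whiteCell_injective.swap_apply, Equiv.Perm.mul_apply,
          σ.injective.map_swap]
        simp
      · simp only [kasteleyn, Matrix.of_apply, Equiv.apply_symm_apply]
        rw [← hμw, ← hμw, hpA, hqC]
        exact w₂
  -- The horizontal tiling indexes both colour classes, so it corresponds to the identity, and all
  -- its weights are `1`.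
  · intro μ hμ σ hσ
    have : σ = 1 := by
      ext1 p
      apply whiteCell_injective
      rw [← hσ p]
      have := hμ _ _ (blackCell_lt p).1 (blackCell_lt p).2
      rw [Prod.mk.eta] at this
      rw [this, Equiv.Perm.one_apply, horizontalPartner_blackCell]
    rw [this, Equiv.Perm.sign_one]
    simp only [Equiv.Perm.one_apply, Units.val_one, one_mul]
    refine Finset.prod_eq_one fun p _ => ?_
    rw [kasteleyn, Matrix.of_apply]
    refine edgeWeight_of_row ⟨rfl, ?_⟩
    simp only [blackCell, whiteCell]
    omega

/-! ### Kernels modulo a prime and determinants -/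

/-- If the reduction modulo `p` of an integer matrix has a kernel of dimension `d`, then `p ^ d`
divides the determinant. -/
theorem pow_finrank_ker_dvd_det {P : Type*} [Fintype P] [DecidableEq P] (p : ℕ) [Fact p.Prime]
    (K : Matrix P P ℤ) :
    (p : ℤ) ^ Module.finrank (ZMod p)
      (LinearMap.ker (K.map (Int.castRingHom (ZMod p))).mulVecLin) ∣ K.det := by
  classical
  have hp : p.Prime := Fact.out
  set N := LinearMap.ker (K.map (Int.castRingHom (ZMod p))).mulVecLin
  -- A basis adapted to the kernel is lifted to the columns of an integer matrix `L` with
  -- determinant prime to `p`. Each column of `K * L` over a kernel vector is divisible by `p`, and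
  -- pulling out these factors gives the power of `p`.
  obtain ⟨W, hW⟩ := N.exists_isCompl
  let b := ((Module.finBasis (ZMod p) N).prod (Module.finBasis (ZMod p) W)).map
    (Submodule.prodEquivOfIsCompl N W hW)
  let e := b.indexEquiv (Pi.basisFun (ZMod p) P)
  let U : Matrix P P (ZMod p) := Matrix.of fun i j => b (e.symm j) i
  have hU : U.det ≠ 0 := by
    rw [← isUnit_iff_ne_zero, ← Matrix.isUnit_iff_isUnit_det,
      ← Matrix.linearIndependent_cols_iff_isUnit]
    have := (b.reindex e).linearIndependent
    have hcol : U.col = b.reindex e := by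
      ext j i
      simp [U, Matrix.col]
    rw [hcol]
    exact this
  let L : Matrix P P ℤ := U.map fun x => (x.val : ℤ)
  have hL : L.map (Int.castRingHom (ZMod p)) = U := by
    ext i j
    simp [L]
  have hLdet : ¬ (p : ℤ) ∣ L.det := by
    rw [← ZMod.intCast_zmod_eq_zero_iff_dvd, ← eq_intCast (Int.castRingHom (ZMod p)),
      RingHom.map_det, RingHom.mapMatrix_apply, hL]
    exact hU
  let v : P → ℤ := fun j => Sum.elim (fun _ => (p : ℤ)) (fun _ => 1) (e.symm j)
  have hdvd : ∀ i j, v j ∣ (K * L) i j := by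
    intro i j
    rcases hj : e.symm j with k | k
    · simp only [v, hj, Sum.elim_inl]
      have hmem : b (e.symm j) ∈ N := by
        rw [hj]
        simp [b]
      have hi := congrFun (LinearMap.mem_ker.1 hmem) i
      rw [← ZMod.intCast_zmod_eq_zero_iff_dvd, ← eq_intCast (Int.castRingHom (ZMod p)),
        ← Matrix.map_apply (f := Int.castRingHom (ZMod p)), Matrix.map_mul, hL, Matrix.mul_apply]
      exact hi
    · simp [v, hj]
  choose A hA using hdvd
  have hdet : (K * L).det = (∏ j, v j) * (Matrix.of A).det := by
    rw [← Matrix.det_mul_row]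
    congr 1
    ext i j
    exact hA i j
  have hv : ∏ j, v j = (p : ℤ) ^ Module.finrank (ZMod p) N := by
    rw [← e.prod_comp]
    simp [v, Fintype.prod_sum_type]
  rw [Matrix.det_mul, hv] at hdet
  exact (Nat.prime_iff_prime_int.1 hp).pow_dvd_of_dvd_mul_right _ hLdet ⟨_, hdet⟩

/-! ### Kasteleyn's theorem for grid graphs and its reduction modulo 2 -/

theorem rectGrid_adj {a b : ℕ} {u v : Fin a × Fin b} :
    (rectGrid a b).Adj u v ↔ CellAdj (u.1.val, u.2.val) (v.1.val, v.2.val) := by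
  simp only [SimpleGraph.boxProd_adj, SimpleGraph.pathGraph_adj, CellAdj, Fin.ext_iff]
  tauto

/-- The black vertex of the `p`-th horizontal edge. -/
def blackVertex (p : Fin a × Fin h) : Fin a × Fin (2 * h) :=
  (⟨(blackCell p).1, (blackCell_lt p).1⟩, ⟨(blackCell p).2, (blackCell_lt p).2⟩)

/-- The white vertex of the `p`-th horizontal edge. -/
def whiteVertex (p : Fin a × Fin h) : Fin a × Fin (2 * h) :=
  (⟨(whiteCell p).1, (whiteCell_lt p).1⟩, ⟨(whiteCell p).2, (whiteCell_lt p).2⟩)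

theorem bijective_blackVertex_whiteVertex :
    Function.Bijective (Sum.elim (blackVertex (a := a) (h := h)) whiteVertex) := by
  have inj : ∀ {u v : Fin a × Fin (2 * h)}, u = v → (u.1.val, u.2.val) = (v.1.val, v.2.val) := by
    rintro u v rfl
    rfl
  constructor
  · rintro (p | p) (q | q) e
    · exact congrArg Sum.inl (blackCell_injective (inj e))
    · exact absurd (inj e) (blackCell_ne_whiteCell p q)
    · exact absurd (inj e).symm (blackCell_ne_whiteCell q p)
    · exact congrArg Sum.inr (whiteCell_injective (inj e))
  · rintro ⟨x, y⟩
    rcases Nat.mod_two_eq_zero_or_one (x.val + y.val) with hp | hp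
    · obtain ⟨p, hp⟩ := exists_blackCell (v := (x.val, y.val)) x.2 y.2 hp
      exact ⟨Sum.inl p, Prod.ext (Fin.ext (congrArg Prod.fst hp)) (Fin.ext (congrArg Prod.snd hp))⟩
    · obtain ⟨p, hp⟩ := exists_whiteCell (v := (x.val, y.val)) x.2 y.2 hp
      exact ⟨Sum.inr p, Prod.ext (Fin.ext (congrArg Prod.fst hp)) (Fin.ext (congrArg Prod.snd hp))⟩

theorem CellAdj.parity {u v : ℕ × ℕ} (huv : CellAdj u v) : (u.1 + u.2 + v.1 + v.2) % 2 = 1 := by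
  simp only [CellAdj] at huv
  omega

theorem not_adj_blackVertex (p q : Fin a × Fin h) :
    ¬ (rectGrid a (2 * h)).Adj (blackVertex p) (blackVertex q) := by
  intro hadj
  have h₁ := (rectGrid_adj.1 hadj).parity
  have h₂ := blackCell_parity p
  have h₃ := blackCell_parity q
  simp only [blackVertex] at h₁
  omega

theorem not_adj_whiteVertex (p q : Fin a × Fin h) :
    ¬ (rectGrid a (2 * h)).Adj (whiteVertex p) (whiteVertex q) := by
  intro hadj
  have h₁ := (rectGrid_adj.1 hadj).parity
  have h₂ := whiteCell_parity p
  have h₃ := whiteCell_parity q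
  simp only [whiteVertex] at h₁
  omega

theorem rectGrid_adj_blackVertex_whiteVertex (p q : Fin a × Fin h) :
    (rectGrid a (2 * h)).Adj (blackVertex p) (whiteVertex q) ↔
      CellAdj (blackCell p) (whiteCell q) := rectGrid_adj

/-- Kasteleyn's theorem for the rectangles of even width. -/
theorem numMatchings_eq_det_kasteleyn (a h : ℕ) :
    (numMatchings (rectGrid a (2 * h)) : ℤ) = (kasteleyn a h).det := by
  classical
  rw [numMatchings_eq_card_perm _ _ _ bijective_blackVertex_whiteVertex not_adj_blackVertex
    not_adj_whiteVertex, ← Matrix.det_transpose, Matrix.det_apply', Nat.card_eq_fintype_card,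
    Fintype.card_subtype, Finset.cast_card, Finset.sum_filter]
  refine Finset.sum_congr rfl fun σ _ => ?_
  simp only [rectGrid_adj_blackVertex_whiteVertex, Matrix.transpose_apply]
  split_ifs with hσ
  · exact (kasteleyn_sign σ hσ).symm
  · push Not at hσ
    obtain ⟨p, hp⟩ := hσ
    rw [Finset.prod_eq_zero (Finset.mem_univ p), mul_zero]
    rw [kasteleyn, Matrix.of_apply, edgeWeight_of_not_adj hp]

open Classical in
theorem kasteleyn_cast (p q : Fin a × Fin h) :
    ((kasteleyn a h p q : ℤ) : ZMod 2) =
      if (rectGrid a (2 * h)).Adj (whiteVertex q) (blackVertex p) then 1 else 0 := by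
  rw [SimpleGraph.adj_comm]
  simp only [rectGrid_adj_blackVertex_whiteVertex]
  split_ifs with hadj
  · rcases hadj with hadj | hadj
    · rw [kasteleyn, Matrix.of_apply, edgeWeight_of_row hadj, Int.cast_one]
    · rw [kasteleyn, Matrix.of_apply, edgeWeight_of_column hadj]
      push_cast
      have : (-1 : ZMod 2) = 1 := by decide
      rw [this, one_pow]
  · rw [kasteleyn, Matrix.of_apply, edgeWeight_of_not_adj hadj, Int.cast_zero]

/-- The chessboard colouring of a rectangular grid graph. -/
def chessboard (a b : ℕ) : (rectGrid a b).Coloring Bool :=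
  SimpleGraph.Coloring.mk (fun v => decide ((v.1.val + v.2.val) % 2 = 0)) (by
    intro u v huv e
    have := (rectGrid_adj.1 huv).parity
    rw [decide_eq_decide] at e
    simp only at this
    omega)

theorem chessboard_eq_true {a b : ℕ} (v : Fin a × Fin b) :
    chessboard a b v = true ↔ (v.1.val + v.2.val) % 2 = 0 :=
  decide_eq_true_iff

/-- Modulo 2 every edge weight is `1`. Rows are indexed by black vertices, so it is the transpose
that sends a function on black vertices to its neighbour sums at white ones; the sums at black
vertices vanish automatically. -/
theorem card_ker_kasteleyn (a h : ℕ) :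
    Nat.card (LinearMap.ker
      ((kasteleyn a h).transpose.map (Int.castRingHom (ZMod 2))).mulVecLin) =
      Nat.card (blackKernel (rectGrid a (2 * h)) (chessboard a (2 * h))) := by
  classical
  have hbl : ∀ p : Fin a × Fin h, chessboard a (2 * h) (blackVertex p) = true := fun p =>
    (chessboard_eq_true _).2 (blackCell_parity p)
  have hwh : ∀ p : Fin a × Fin h, chessboard a (2 * h) (whiteVertex p) ≠ true := fun p e => by
    have h₁ := (chessboard_eq_true _).1 e
    have h₂ := whiteCell_parity p
    simp only [whiteVertex] at h₁
    omega
  have hsum : ∀ (f : Fin a × Fin (2 * h) → ZMod 2) v,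
      ∑ w, (if (rectGrid a (2 * h)).Adj v w then f w else 0) =
      ∑ p : Fin a × Fin h,
        (if (rectGrid a (2 * h)).Adj v (blackVertex p) then f (blackVertex p) else 0) +
      ∑ p : Fin a × Fin h,
        (if (rectGrid a (2 * h)).Adj v (whiteVertex p) then f (whiteVertex p) else 0) := by
    intro f v
    rw [← bijective_blackVertex_whiteVertex.sum_comp, Fintype.sum_sum_type]
    rfl
  have hker : ∀ (g : Fin a × Fin h → ZMod 2),
      g ∈ LinearMap.ker ((kasteleyn a h).transpose.map (Int.castRingHom (ZMod 2))).mulVecLin ↔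
      ∀ q, ∑ p, (if (rectGrid a (2 * h)).Adj (whiteVertex q) (blackVertex p) then g p else 0) =
        0 := by
    intro g
    rw [LinearMap.mem_ker, funext_iff]
    refine forall_congr' fun q => ?_
    rw [Matrix.mulVecLin_apply, Matrix.mulVec, dotProduct, Pi.zero_apply]
    refine Eq.congr_left (Finset.sum_congr rfl fun p _ => ?_)
    rw [Matrix.map_apply, Matrix.transpose_apply, eq_intCast, kasteleyn_cast, ite_mul, one_mul,
      zero_mul]
  refine (Nat.card_congr (Equiv.ofBijective
    (fun f : blackKernel (rectGrid a (2 * h)) (chessboard a (2 * h)) =>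
      (⟨fun p => f.1 (blackVertex p), (hker _).2 fun q => ?_⟩ : LinearMap.ker
        ((kasteleyn a h).transpose.map (Int.castRingHom (ZMod 2))).mulVecLin)) ⟨?_, ?_⟩)).symm
  · obtain ⟨h₁, h₂⟩ := mem_blackKernel.1 f.2
    have := h₁ (whiteVertex q)
    rw [hsum] at this
    simp only [h₂ _ (hwh _), ite_self, Finset.sum_const_zero, add_zero] at this
    exact this
  · rintro ⟨f, hf⟩ ⟨f', hf'⟩ e
    apply Subtype.ext
    funext v
    obtain ⟨p | p, rfl⟩ := bijective_blackVertex_whiteVertex.2 v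
    · exact congrFun (congrArg Subtype.val e) p
    · exact ((mem_blackKernel.1 hf).2 _ (hwh p)).trans ((mem_blackKernel.1 hf').2 _ (hwh p)).symm
  · rintro ⟨g, hg⟩
    let E := Equiv.ofBijective _ (bijective_blackVertex_whiteVertex (a := a) (h := h))
    let f : Fin a × Fin (2 * h) → ZMod 2 := fun v => Sum.elim g 0 (E.symm v)
    have fbl : ∀ p, f (blackVertex p) = g p := fun p => by
      have : E.symm (blackVertex p) = Sum.inl p := E.symm_apply_eq.2 rfl
      simp only [f, this, Sum.elim_inl]
    have fwh : ∀ p, f (whiteVertex p) = 0 := fun p => by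
      have : E.symm (whiteVertex p) = Sum.inr p := E.symm_apply_eq.2 rfl
      simp only [f, this, Sum.elim_inr, Pi.zero_apply]
    refine ⟨⟨f, mem_blackKernel.2 ⟨fun v => ?_, fun v hv => ?_⟩⟩,
      Subtype.ext (funext fun p => fbl p)⟩
    · rw [hsum]
      simp only [fbl, fwh, ite_self, Finset.sum_const_zero, add_zero]
      obtain ⟨p | q, rfl⟩ := bijective_blackVertex_whiteVertex.2 v
      · exact Finset.sum_eq_zero fun q _ => if_neg (not_adj_blackVertex p q)
      · exact (hker g).1 hg q
    · obtain ⟨p | p, rfl⟩ := bijective_blackVertex_whiteVertex.2 v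
      · exact absurd (hbl p) hv
      · exact fwh p

/-- Divisibility and parity of the number of perfect matchings of a rectangle of even width, in
terms of the kernel of the adjacency matrix modulo `2`. -/
theorem numMatchings_of_card_blackKernel {d : ℕ}
    (hd : Nat.card (blackKernel (rectGrid a (2 * h)) (chessboard a (2 * h))) = 2 ^ d) :
    2 ^ d ∣ numMatchings (rectGrid a (2 * h)) ∧
      (d = 0 → Odd (numMatchings (rectGrid a (2 * h)))) := by
  classical
  rw [← card_ker_kasteleyn] at hd
  have hdet := numMatchings_eq_det_kasteleyn a h
  rw [← Matrix.det_transpose] at hdet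
  constructor
  · have hfin := Module.card_eq_pow_finrank (K := ZMod 2)
      (V := LinearMap.ker ((kasteleyn a h).transpose.map (Int.castRingHom (ZMod 2))).mulVecLin)
    rw [← Nat.card_eq_fintype_card, hd, ZMod.card] at hfin
    have := pow_finrank_ker_dvd_det 2 (kasteleyn a h).transpose
    rw [← Nat.pow_right_injective le_rfl hfin, ← hdet] at this
    exact_mod_cast this
  · rintro rfl
    rw [← ZMod.natCast_ne_zero_iff_odd, ← Int.cast_natCast, hdet,
      ← eq_intCast (Int.castRingHom (ZMod 2)), RingHom.map_det, RingHom.mapMatrix_apply]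
    intro h0
    obtain ⟨v, hv, hmul⟩ := Matrix.exists_mulVec_eq_zero_iff.2 h0
    have hsub := (Nat.card_eq_one_iff_unique.1 hd).1
    exact hv (congrArg Subtype.val (hsub.elim ⟨v, LinearMap.mem_ker.2 hmul⟩ 0))

end Kasteleyn

/-! ### Parity of the sides and the main theorem -/

/-- The Kasteleyn matrix is set up for even width; transposing the rectangle covers the case where
only the other side is even. -/
theorem numMatchings_rectGrid_comm (a h : ℕ) :
    numMatchings (rectGrid (2 * h) a) = numMatchings (rectGrid a (2 * h)) := by
  have hadj : ∀ u v : Fin a × Fin (2 * h),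
      (rectGrid (2 * h) a).Adj u.swap v.swap ↔ (rectGrid a (2 * h)).Adj u v := by
    intro u v
    simp only [SimpleGraph.boxProd_adj, Prod.fst_swap, Prod.snd_swap]
    exact Or.comm
  rw [numMatchings_eq_card_perm _ _ _ bijective_blackVertex_whiteVertex not_adj_blackVertex
    not_adj_whiteVertex, numMatchings_eq_card_perm (P := Fin a × Fin h) _
    (fun p => (blackVertex p).swap) (fun p => (whiteVertex p).swap)]
  · simp only [hadj]
  · have : Sum.elim (fun p : Fin a × Fin h => (blackVertex p).swap)
        (fun p => (whiteVertex p).swap) =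
        Prod.swap ∘ Sum.elim (blackVertex (a := a) (h := h)) whiteVertex := by
      funext p
      rcases p with p | p <;> rfl
    rw [this]
    exact Prod.swap_bijective.comp bijective_blackVertex_whiteVertex
  · exact fun p q => (hadj _ _).not.2 (not_adj_blackVertex p q)
  · exact fun p q => (hadj _ _).not.2 (not_adj_whiteVertex p q)

theorem odd_gcd_of_even_mul {m n : ℕ} (h : Even ((m + 1) * (n + 1))) : Odd (Nat.gcd m n) := by
  rw [← Nat.not_even_iff_odd]
  intro hg
  have h₁ : Even m := (even_iff_two_dvd.1 hg).trans (Nat.gcd_dvd_left m n) |> even_iff_two_dvd.2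
  have h₂ : Even n := (even_iff_two_dvd.1 hg).trans (Nat.gcd_dvd_right m n) |> even_iff_two_dvd.2
  rw [Nat.even_mul, Nat.even_add_one, Nat.even_add_one] at h
  tauto

theorem numMatchings_of_odd_gcd {m n : ℕ} (hm : 1 ≤ m) (hn : 1 ≤ n) (hg : Odd (Nat.gcd m n)) :
    2 ^ ((Nat.gcd m n - 1) / 2) ∣ numMatchings (rectGrid (m - 1) (n - 1)) ∧
      ((Nat.gcd m n - 1) / 2 = 0 → Odd (numMatchings (rectGrid (m - 1) (n - 1)))) := by
  have key : ∀ m h : ℕ, 1 ≤ m → Odd (Nat.gcd m (2 * h + 1)) →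
      2 ^ ((Nat.gcd m (2 * h + 1) - 1) / 2) ∣ numMatchings (rectGrid (m - 1) (2 * h)) ∧
      ((Nat.gcd m (2 * h + 1) - 1) / 2 = 0 → Odd (numMatchings (rectGrid (m - 1) (2 * h)))) :=
    fun m h hm hg => numMatchings_of_card_blackKernel
      (card_blackKernel hm (by omega) hg (chessboard (m - 1) (2 * h)))
  rcases Nat.even_or_odd n with hn2 | ⟨h, rfl⟩
  · have hm2 : Odd m := by
      rw [← Nat.not_even_iff_odd]
      intro hm2
      rw [← Nat.not_even_iff_odd] at hg
      exact hg (even_iff_two_dvd.2 (Nat.dvd_gcd hm2.two_dvd hn2.two_dvd))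
    obtain ⟨h, rfl⟩ := hm2
    rw [Nat.gcd_comm, Nat.add_sub_cancel, numMatchings_rectGrid_comm]
    rw [Nat.gcd_comm] at hg
    exact key n h hn hg
  · exact key m h hm hg

/-- Both `m` and `n` are even, so the rectangle has an odd number of vertices. -/
theorem numMatchings_of_even_gcd {m n : ℕ} (hm : 1 ≤ m) (hn : 1 ≤ n) (hg : Even (Nat.gcd m n)) :
    numMatchings (rectGrid (m - 1) (n - 1)) = 0 := by
  have h₁ : Even m := (even_iff_two_dvd.1 hg).trans (Nat.gcd_dvd_left m n) |> even_iff_two_dvd.2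
  have h₂ : Even n := (even_iff_two_dvd.1 hg).trans (Nat.gcd_dvd_right m n) |> even_iff_two_dvd.2
  rw [numMatchings, Set.ncard_eq_zero, Set.eq_empty_iff_forall_notMem]
  intro M hM
  have := hM.even_card
  rw [Fintype.card_prod, Fintype.card_fin, Fintype.card_fin, Nat.even_mul] at this
  rw [Nat.even_iff] at h₁ h₂ this
  rw [Nat.even_iff] at this
  omega

end GridChannels

theorem mainTheorem4 (m n : ℕ) (hm : 1 ≤ m) (hn : 1 ≤ n) :
    (Even ((m + 1) * (n + 1)) →
      ∀ c : (GridChannels.rectGrid (m + 1) (n + 1)).Coloring Bool,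
        LinearIndepOn (ZMod 2) GridChannels.faceVec (GridChannels.pathBasis c) ∧
        (Submodule.span (ZMod 2) (GridChannels.faceVec '' GridChannels.pathBasis c) :
            Set (GridChannels.Face m n → ZMod 2)) =
          GridChannels.faceVec '' {B | GridChannels.IsBilliardNest c B} ∧
        2 * (GridChannels.pathBasis c).ncard = Nat.gcd m n + 1) ∧
    (Even ((m - 1) * (n - 1)) →
      ∀ c : (GridChannels.rectGrid (m - 1) (n - 1)).Coloring Bool,
        (GridChannels.blackChannels (GridChannels.rectGrid (m - 1) (n - 1)) c).ncard =
          2 ^ ((Nat.gcd m n - 1) / 2)) ∧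
    (2 ^ ((Nat.gcd m n - 1) / 2) ∣
        GridChannels.numMatchings (GridChannels.rectGrid (m - 1) (n - 1)) ∧
      (Even (Nat.gcd m n) →
        GridChannels.numMatchings (GridChannels.rectGrid (m - 1) (n - 1)) = 0)) ∧
    (Odd (GridChannels.numMatchings (GridChannels.rectGrid (m - 1) (n - 1))) ↔
      Nat.Coprime m n) := by
  have hpos : 0 < Nat.gcd m n := Nat.gcd_pos_of_pos_left n hm
  refine ⟨fun h c => ⟨GridChannels.linearIndepOn_pathBasis c, GridChannels.span_pathBasis c,
    GridChannels.ncard_pathBasis c hm hn (GridChannels.odd_gcd_of_even_mul h)⟩, fun h c => ?_,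
    ⟨?_, GridChannels.numMatchings_of_even_gcd hm hn⟩, ?_⟩
  · have hg : Odd (Nat.gcd m n) := by
      apply GridChannels.odd_gcd_of_even_mul
      rw [Nat.even_mul, Nat.even_sub hm] at h
      rw [Nat.even_sub hn] at h
      rw [Nat.even_mul, Nat.even_add_one, Nat.even_add_one]
      simp only [Nat.not_even_one, iff_false] at h
      exact h
    rw [GridChannels.ncard_blackChannels]
    exact GridChannels.card_blackKernel hm hn hg c
  · rcases Nat.even_or_odd (Nat.gcd m n) with hg | hg
    · rw [GridChannels.numMatchings_of_even_gcd hm hn hg]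
      exact dvd_zero _
    · exact (GridChannels.numMatchings_of_odd_gcd hm hn hg).1
  · rw [Nat.coprime_iff_gcd_eq_one]
    rcases Nat.even_or_odd (Nat.gcd m n) with hg | hg
    · rw [GridChannels.numMatchings_of_even_gcd hm hn hg]
      refine iff_of_false (by decide) fun h => ?_
      rw [h] at hg
      exact absurd hg (by decide)
    · obtain ⟨h₁, h₂⟩ := GridChannels.numMatchings_of_odd_gcd hm hn hg
      constructor
      · intro hodd
        by_contra hne
        rw [← Nat.not_even_iff_odd] at hodd
        refine hodd (even_iff_two_dvd.2 ((dvd_pow_self 2 ?_).trans h₁))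
        obtain ⟨k, hk⟩ := hg
        omega
      · intro h
        exact h₂ (by omega)
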